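/- Let $n\ge 1$, and let $\hat K\subseteq\mathbb R^{n+1}$ be a compact, strictly convex set with smooth boundary whose Gaussian curvature (the determinant of the shape operator $X\mapsto\nabla_X\mathsf N$ with respect to the outward unit normal $\mathsf N$) is everywhere at least $k>0$. Let $\Omega$ be an open subset of $\partial\hat K$ with smooth boundary in $\partial\hat K$, write $\Omega^c=\partial\hat K\setminus\Omega$, and let $K_0$ be the convex hull of $\Omega^c$. Let $0<t\le k$, and suppose that the Gaussian curvature of $\partial\hat K$ is strictly greater than $t$ at every point of $\Omega$ (this holds automatically if $t<k$). Let $F_t$ be the set of non-negative semi-definite symmetric real $n\times n$ matrices $A$ with $\det A\ge t$, and let $\overline{F_t^c}$ be the closure of its complement in the space of symmetric $n\times n$ matrices. For a compact set $X\subset\mathbb R^{n+1}$ and a set $W\subseteq\mathbb R^{n+1}$, say that * $X$ is of type $F_t$ over $W$ if, for every $p\in\partial X\cap W$ and every open subset $U$ of the interior of $X$ with smooth boundary and $p\in\partial U$, the shape operator of $\partial U$ at $p$ with respect to the normal pointing out of $U$ is conjugate (that is, has a matrix in an orthonormal basis of the tangent space equal) to an element of $F_t$; * $X$ is of dual type $F_t'$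 over $W$ if, for every $p\in\partial X\cap W$ and every open subset $U$ of the complement of $X$ with smooth boundary and $p\in\partial U$, the shape operator of $\partial U$ at $p$ with respect to the normal pointing into $U$ is conjugate to an element of $\overline{F_t^c}$. (An open set has smooth boundary if near each of its boundary points it is $\{f<0\}$ for a smooth function $f$ that vanishes at the point and has nonzero differential there.) Then there is a compact convex set $K_t\subseteq\hat K$ such that 1. $K_0\subseteq K_t$; 2. $K_t\cap\partial\hat K=\Omega^c$; 3. $K_t$ is of type $F_t$ and of dual type $F_t'$ over the interior of $\hat K$; that is, in this (viscosity) sense, $\partial K_t$ has constant Gaussian curvature $t$ in the interior of $\hat K$. Moreover, $K_t$ can be taken to be the intersection of all compact convex sets $Y$ with $K_0\subseteq Y\subseteq\hat K$ that are of type $F_t$ over $\mathbb R^{n+1}$. -/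

import Mathlib

open Set Filter Topology
open scoped ContDiff InnerProductSpace

noncomputable section

namespace Plateau

/-- The Euclidean space `ℝ^{n+1}`. -/
abbrev Space (n : ℕ) : Type := EuclideanSpace ℝ (Fin (n + 1))

/-- `Symm(ℝ^n)`, with the topology induced by that of the matrices. -/
abbrev SymmMatrix (n : ℕ) : Type := {A : Matrix (Fin n) (Fin n) ℝ // A.IsSymm}

/-- `f` is a smooth defining function of `X` near `p`: near `p` the interior of `X` is `{f < 0}`, its
closure is `{f ≤ 0}`, and the gradient of `f` at `p` is nonzero. Only the germ of `f` at `p` matters;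
every smooth germ extends to a smooth function on the whole space. -/
structure IsDefiningFunction {n : ℕ} (X : Set (Space n)) (p : Space n) (f : Space n → ℝ) :
    Prop where
  smooth : ContDiff ℝ ∞ f
  gradient_ne_zero : gradient f p ≠ 0
  interior_iff : ∀ᶠ q in 𝓝 p, (q ∈ interior X ↔ f q < 0)
  closure_iff : ∀ᶠ q in 𝓝 p, (q ∈ closure X ↔ f q ≤ 0)

/-- The boundary of `X` is a smooth embedded hypersurface and `X` lies locally on one side of it. -/
def HasSmoothBoundary {n : ℕ} (X : Set (Space n)) : Prop :=
  ∀ p ∈ frontier X, ∃ f : Space n → ℝ, IsDefiningFunction X p f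

/-- The unit normal field of the level sets of `f` in the direction of increasing `f`; when `f` is a
defining function of `X`, its restriction to the boundary of `X` is the outward unit normal. -/
def outwardNormal {n : ℕ} (f : Space n → ℝ) (q : Space n) : Space n :=
  ‖gradient f q‖⁻¹ • gradient f q

/-- The inward unit normal. -/
def inwardNormal {n : ℕ} (f : Space n → ℝ) (q : Space n) : Space n :=
  -outwardNormal f q

/-- The tangent hyperplane at `p` of a hypersurface with unit normal field `N`. -/
abbrev tangentHyperplane {n : ℕ} (N : Space n → Space n) (p : Space n) :
    Submodule ℝ (Space n) :=
  (Submodule.span ℝ {N p})ᗮ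

/-- The shape operator at `p` of a hypersurface with unit normal field `N`, with the sign convention
`A X = ∇_X N`. (As `N` has length one, `∇_X N` is tangent and the projection only adjusts the
type.) -/
def shapeOperator {n : ℕ} (N : Space n → Space n) (p : Space n) :
    tangentHyperplane N p →ₗ[ℝ] tangentHyperplane N p :=
  ((tangentHyperplane N p).orthogonalProjectionOnto ∘L
    (fderiv ℝ N p ∘L (tangentHyperplane N p).subtypeL)).toLinearMap

/-- The shape operator at `p` with respect to the unit normal field `N` is conjugate to a matrix in
`F`: its matrix in some orthonormal basis of the tangent hyperplane lies in `F`. -/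
def ShapeOperatorIn {n : ℕ} (F : Set (SymmMatrix n)) (N : Space n → Space n) (p : Space n) :
    Prop :=
  ∃ b : OrthonormalBasis (Fin n) ℝ (tangentHyperplane N p), ∃ A ∈ F,
    LinearMap.toMatrix b.toBasis b.toBasis (shapeOperator N p) = A.1

/-- The Gaussian curvature at `p` of the boundary of a set with defining function `f` near `p`: the
determinant of the shape operator with respect to the outward unit normal. -/
def gaussCurvature {n : ℕ} (f : Space n → ℝ) (p : Space n) : ℝ :=
  LinearMap.det (shapeOperator (outwardNormal f) p)

/-- `X` is of type `F` over `W`. The shape operator of the boundary of `U` at `p` does not depend on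
the defining function `f` of `U` near `p`, and such an `f` exists, as `U` has smooth boundary. -/
def IsOfType {n : ℕ} (F : Set (SymmMatrix n)) (X W : Set (Space n)) : Prop :=
  ∀ p ∈ frontier X ∩ W, ∀ U : Set (Space n), IsOpen U → U ⊆ interior X →
    HasSmoothBoundary U → p ∈ frontier U →
      ∀ f : Space n → ℝ, IsDefiningFunction U p f → ShapeOperatorIn F (outwardNormal f) p

/-- `X` is of (dual) type `F'` over `W`. The closure of the complement is taken in `Symm(ℝ^n)`. -/
def IsOfDualType {n : ℕ} (F : Set (SymmMatrix n)) (X W : Set (Space n)) : Prop :=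
  ∀ p ∈ frontier X ∩ W, ∀ U : Set (Space n), IsOpen U → U ⊆ Xᶜ →
    HasSmoothBoundary U → p ∈ frontier U →
      ∀ f : Space n → ℝ, IsDefiningFunction U p f →
        ShapeOperatorIn (closure Fᶜ) (inwardNormal f) p

/-- `F_t`: the non-negative semi-definite symmetric matrices of determinant at least `t`. -/
def detSet (n : ℕ) (t : ℝ) : Set (SymmMatrix n) :=
  {A | A.1.PosSemidef ∧ t ≤ A.1.det}

/-- `Ω` is an open subset of the hypersurface `∂K`. -/
def IsOpenInBoundary {n : ℕ} (K Ω : Set (Space n)) : Prop :=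
  ∃ O : Set (Space n), IsOpen O ∧ Ω = frontier K ∩ O

/-- The boundary of the open subset `Ω` of the smooth hypersurface `∂K` is smooth: near each of its
points, `Ω` is the part of `∂K` where `g < 0`, for a smooth function `g` whose restriction to `∂K`
has nonzero differential there, that is, whose gradient is not normal to `∂K`. -/
def HasSmoothBoundaryInBoundary {n : ℕ} (K Ω : Set (Space n)) : Prop :=
  ∀ x ∈ closure Ω \ Ω, ∃ f g : Space n → ℝ, IsDefiningFunction K x f ∧ ContDiff ℝ ∞ g ∧
    LinearIndependent ℝ ![gradient f x, gradient g x] ∧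
    ∀ᶠ q in 𝓝[frontier K] x, (q ∈ Ω ↔ g q < 0)

/-- The compact convex sets of type `F` (at all their boundary points) between `K₀` and `K`. -/
def perronFamily {n : ℕ} (F : Set (SymmMatrix n)) (K₀ K : Set (Space n)) :
    Set (Set (Space n)) :=
  {Y | IsCompact Y ∧ Convex ℝ Y ∧ K₀ ⊆ Y ∧ Y ⊆ K ∧ IsOfType F Y univ}

end Plateau

end

open Set Filter Topology
open scoped ContDiff InnerProductSpace

noncomputable section

/-! This is Perron's method: `K` is the intersection of all competitors, and minimality forces
curvature `t`. The family is nonempty because `Khat` itself belongs to it, its curvature being at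
least `k ≥ t`.

Two facts carry the argument. First, "curvature at least `t`" in the viscosity sense survives
arbitrary intersections of convex sets (`isOfType_sInter`): a smooth surface touching the
intersection from inside with curvature below `t` can be bent and shifted until it touches one
member from inside with curvature still below `t`. Second, a set of type `F_t` touched from outside
by a surface of curvature above `t` is not minimal (`exists_subset_isOfType`): a convex quadric
slightly flatter than that surface cuts off a small piece near the contact point and leaves a
smaller set of type `F_t`.

If the dual condition failed at a point of `∂K` inside `Khat`, the second fact would give a smaller
competitor. Applied to `Khat` at a point of `Ω`, where the curvature exceeds `t`, it gives a
competitor missing that point, so `K` meets `∂Khat` exactly in the complement of `Ω`.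

Touching sets are handled through their defining functions. `comparison` orders the Hessians of
tangent functions, and `curvature` writes Gaussian curvature as a determinant on the fixed ambient
space, continuous in gradient and Hessian. -/

namespace Plateau

/-! ### Monotonicity of the determinant and positivity of quadratic forms. -/

section LinearAlgebra

theorem one_le_det_one_add {m : Type*} [Fintype m] [DecidableEq m] {D : Matrix m m ℝ}
    (hD : D.PosSemidef) : 1 ≤ (1 + D).det := by
  have h1 : (1 + D).IsHermitian := Matrix.isHermitian_one.add hD.1
  rw [h1.det_eq_prod_eigenvalues]
  simp only [RCLike.ofReal_real_eq_id, id_eq]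
  refine Finset.prod_induction _ (fun x : ℝ => 1 ≤ x)
    (fun a b ha hb => one_le_mul_of_one_le_of_one_le ha hb)
    le_rfl fun i _ => ?_
  have hmem := h1.eigenvalues_mem_spectrum_real i
  have h2 : h1.eigenvalues i - 1 ∈ spectrum ℝ D := by
    rw [spectrum.mem_iff] at hmem ⊢
    rwa [map_sub, map_one, sub_sub]
  have h3 := (Matrix.posSemidef_iff_isHermitian_and_spectrum_nonneg.1 hD).2 h2
  simp only [mem_ofPred_eq] at h3
  linarith

open scoped MatrixOrder in
-- When `A = yᴴ y` is invertible, `B = yᴴ (1 + D) y` with `D` the congruence of `B - A` by `y⁻¹`,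
-- and all eigenvalues of `1 + D` are at least one.
theorem det_le_det_of_posSemidef_sub {m : Type*} [Fintype m] [DecidableEq m] {A B : Matrix m m ℝ}
    (hA : A.PosSemidef) (hBA : (B - A).PosSemidef) : A.det ≤ B.det := by
  have hB : B.PosSemidef := by simpa using hA.add hBA
  rcases eq_or_ne A.det 0 with h0 | h0
  · rw [h0]; exact hB.det_nonneg
  obtain ⟨y, hy⟩ : ∃ y : Matrix m m ℝ, A = y.conjTranspose * y := by
    refine ⟨(CStarAlgebra.nonneg_iff_eq_star_mul_self.mp hA.nonneg).choose, ?_⟩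
    exact (CStarAlgebra.nonneg_iff_eq_star_mul_self.mp hA.nonneg).choose_spec
  have hdet : A.det = y.det * y.det := by
    rw [hy, Matrix.det_mul, Matrix.det_conjTranspose]; simp
  have hy0 : IsUnit y.det := isUnit_iff_ne_zero.2 fun h => h0 (by rw [hdet, h, zero_mul])
  have hD := hBA.conjTranspose_mul_mul_same y⁻¹
  have hBeq : B = y.conjTranspose * (1 + (y⁻¹).conjTranspose * (B - A) * y⁻¹) * y := by
    rw [mul_add, add_mul, mul_one, ← hy]
    simp only [← mul_assoc]
    rw [← Matrix.conjTranspose_mul, Matrix.nonsing_inv_mul _ hy0, Matrix.conjTranspose_one, one_mul,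
      mul_assoc, Matrix.nonsing_inv_mul _ hy0, mul_one]
    abel
  have h1 := one_le_det_one_add hD
  have : B.det = y.det * y.det * (1 + (y⁻¹).conjTranspose * (B - A) * y⁻¹).det := by
    conv_lhs => rw [hBeq]
    rw [Matrix.det_mul, Matrix.det_mul, Matrix.det_conjTranspose]; simp; ring
  rw [this, hdet]
  nlinarith [mul_self_nonneg y.det]

variable {E : Type*} [NormedAddCommGroup E] [InnerProductSpace ℝ E]

theorem det_le_det_of_isPositive_sub [FiniteDimensional ℝ E] {A B : E →ₗ[ℝ] E}
    (hA : A.IsPositive) (hBA : (B - A).IsPositive) : LinearMap.det A ≤ LinearMap.det B := by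
  let b := stdOrthonormalBasis ℝ E
  rw [← LinearMap.det_toMatrix b.toBasis, ← LinearMap.det_toMatrix b.toBasis]
  refine det_le_det_of_posSemidef_sub ((LinearMap.posSemidef_toMatrix_iff b).2 hA) ?_
  rw [← map_sub]
  exact (LinearMap.posSemidef_toMatrix_iff b).2 hBA

theorem apply_eq_zero_of_isPositive [FiniteDimensional ℝ E] {A : E →ₗ[ℝ] E} (hA : A.IsPositive)
    {x : E} (hx : ⟪A x, x⟫_ℝ = 0) : A x = 0 := by
  have h : ∀ s : ℝ, 0 ≤ ⟪A (x + s • A x), x + s • A x⟫_ℝ := fun s => hA.2 _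
  have h1 : ∀ s : ℝ, 0 ≤ 2 * s * ‖A x‖ ^ 2 + s ^ 2 * ⟪A (A x), A x⟫_ℝ := fun s => by
    have := h s
    rw [map_add, map_smul, inner_add_left, inner_add_right, inner_add_right, inner_smul_left,
      inner_smul_left, inner_smul_right, inner_smul_right, hx, hA.1 (A x) x,
      real_inner_self_eq_norm_sq] at this
    simp only [conj_trivial] at this
    linarith
  by_contra hne
  have hpos : 0 < ‖A x‖ ^ 2 := by positivity
  have hq : 0 ≤ ⟪A (A x), A x⟫_ℝ := hA.2 _
  -- Near `s = 0` the linear term dominates. This negative `s` almost minimises the quadratic; the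
  -- `+ 1` covers the case where its leading coefficient vanishes.
  have h2 := h1 (-(‖A x‖ ^ 2 / (⟪A (A x), A x⟫_ℝ + 1)))
  set a := ‖A x‖ ^ 2
  set c := ⟪A (A x), A x⟫_ℝ
  have : 2 * -(a / (c + 1)) * a + (-(a / (c + 1))) ^ 2 * c
      = - (a ^ 2 / (c + 1) ^ 2) * (c + 2) := by field_simp; ring
  rw [this] at h2
  have : 0 < a ^ 2 / (c + 1) ^ 2 * (c + 2) := by positivity
  linarith

/-- A positive operator with nonzero determinant is bounded below. -/
theorem exists_pos_mul_norm_sq_le [FiniteDimensional ℝ E] {A : E →L[ℝ] E}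
    (hA : A.toLinearMap.IsPositive) (hdet : A.det ≠ 0) :
    ∃ c > 0, ∀ x, c * ‖x‖ ^ 2 ≤ ⟪A x, x⟫_ℝ := by
  rcases subsingleton_or_nontrivial E with hE | hE
  · exact ⟨1, one_pos, fun x => by simp [Subsingleton.elim x 0]⟩
  obtain ⟨u, hu, hmin⟩ := (isCompact_sphere (0 : E) 1).exists_isMinOn
    (NormedSpace.sphere_nonempty.2 zero_le_one)
    (f := fun x => ⟪A x, x⟫_ℝ) (by fun_prop)
  have hu1 : ‖u‖ = 1 := by simpa using hu
  refine ⟨⟪A u, u⟫_ℝ, lt_of_le_of_ne (hA.2 u) fun h => ?_, fun x => ?_⟩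
  · have h0 : A u = 0 := apply_eq_zero_of_isPositive hA h.symm
    have : u = 0 := by
      have hinj := LinearMap.ker_eq_bot.1 (LinearMap.equivOfDetNeZero A.toLinearMap hdet).ker
      apply hinj
      simpa using h0
    simp [this] at hu1
  · rcases eq_or_ne x 0 with rfl | hx
    · simp
    have hx0 : ‖x‖ ≠ 0 := norm_ne_zero_iff.2 hx
    have := hmin (show ‖x‖⁻¹ • x ∈ Metric.sphere (0 : E) 1 by
      simp [norm_smul, hx0])
    simp only [mem_ofPred_eq, map_smul, inner_smul_left, inner_smul_right, conj_trivial] at this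
    have h2 := mul_le_mul_of_nonneg_right this (sq_nonneg ‖x‖)
    refine h2.trans_eq ?_
    field_simp

/-- Finsler's lemma. -/
theorem exists_nonneg_add_mul_inner_sq {A : E →L[ℝ] E} (hsymm : A.toLinearMap.IsSymmetric) {G : E}
    (hG : G ≠ 0) (hA : ∀ v, ⟪G, v⟫_ℝ = 0 → 0 ≤ ⟪A v, v⟫_ℝ) {δ : ℝ} (hδ : 0 < δ) :
    ∃ Λ₀ : ℝ, 0 ≤ Λ₀ ∧ ∀ Λ, Λ₀ ≤ Λ → ∀ h, 0 ≤ ⟪A h, h⟫_ℝ + δ * ‖h‖ ^ 2 + Λ * ⟪G, h⟫_ℝ ^ 2 := by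
  have hg : 0 < ‖G‖ ^ 2 := by positivity
  -- Write `h = a • G + v` with `v ⟂ G`. The first summand of `B` pays for the cross term `2a⟪A G,
  -- v⟫` by the weighted AM-GM inequality, at the cost of `δ ‖v‖²`; the second pays for `a²⟪A G,
  -- G⟫`.
  set B := ‖A G‖ ^ 2 / δ + |⟪A G, G⟫_ℝ| with hB
  have hB0 : 0 ≤ B := by positivity
  refine ⟨B / (‖G‖ ^ 2) ^ 2, by positivity, fun Λ hΛ h => ?_⟩
  set a := ⟪G, h⟫_ℝ / ‖G‖ ^ 2 with ha
  set v := h - a • G with hv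
  have hGh : ⟪G, h⟫_ℝ = a * ‖G‖ ^ 2 := by rw [ha]; field_simp
  have hGv : ⟪G, v⟫_ℝ = 0 := by
    rw [hv, inner_sub_right, inner_smul_right, real_inner_self_eq_norm_sq, hGh, sub_self]
  have hh : h = a • G + v := by rw [hv]; abel
  have hn : ‖h‖ ^ 2 = a ^ 2 * ‖G‖ ^ 2 + ‖v‖ ^ 2 := by
    rw [← real_inner_self_eq_norm_sq, hh, inner_add_left, inner_add_right, inner_add_right,
      inner_smul_left, inner_smul_right, inner_smul_left, inner_smul_right, hGv,
      real_inner_comm G v, hGv, real_inner_self_eq_norm_sq, real_inner_self_eq_norm_sq]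
    simp; ring
  have hAh : ⟪A h, h⟫_ℝ = a ^ 2 * ⟪A G, G⟫_ℝ + 2 * a * ⟪A G, v⟫_ℝ + ⟪A v, v⟫_ℝ := by
    have hs : ⟪A v, G⟫_ℝ = ⟪A G, v⟫_ℝ := by
      rw [real_inner_comm]; exact (hsymm G v).symm
    rw [hh, map_add, map_smul, inner_add_left, inner_add_right, inner_add_right,
      inner_smul_left, inner_smul_right, inner_smul_left, inner_smul_right, hs]
    simp; ring
  have hcs : |⟪A G, v⟫_ℝ| ≤ ‖A G‖ * ‖v‖ := abs_real_inner_le_norm _ _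
  have h1 : - (a ^ 2 * (‖A G‖ ^ 2 / δ) + δ * ‖v‖ ^ 2) ≤ 2 * a * ⟪A G, v⟫_ℝ := by
    have e1 : |2 * a * ⟪A G, v⟫_ℝ| ≤ 2 * |a| * (‖A G‖ * ‖v‖) := by
      rw [abs_mul, abs_mul, abs_two]; gcongr
    have e2 : 2 * |a| * (‖A G‖ * ‖v‖) ≤ a ^ 2 * (‖A G‖ ^ 2 / δ) + δ * ‖v‖ ^ 2 := by
      have := sq_nonneg (|a| * ‖A G‖ - δ * ‖v‖)
      have e3 : a ^ 2 * (‖A G‖ ^ 2 / δ) + δ * ‖v‖ ^ 2 - 2 * |a| * (‖A G‖ * ‖v‖)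
        = (|a| * ‖A G‖ - δ * ‖v‖) ^ 2 / δ := by
        rw [← sq_abs a]; field_simp; ring
      have : 0 ≤ (|a| * ‖A G‖ - δ * ‖v‖) ^ 2 / δ := by positivity
      linarith
    have := neg_abs_le (2 * a * ⟪A G, v⟫_ℝ)
    linarith
  have h2 : B * a ^ 2 ≤ Λ * ⟪G, h⟫_ℝ ^ 2 := by
    rw [hGh]
    have := mul_le_mul_of_nonneg_right hΛ (sq_nonneg (a * ‖G‖ ^ 2))
    refine le_trans (le_of_eq ?_) this
    field_simp
  have h3 : - (a ^ 2 * |⟪A G, G⟫_ℝ|) ≤ a ^ 2 * ⟪A G, G⟫_ℝ := by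
    have := neg_abs_le ⟪A G, G⟫_ℝ
    nlinarith [sq_nonneg a]
  have h4 := hA v hGv
  have h5 : 0 ≤ δ * (a ^ 2 * ‖G‖ ^ 2) := by positivity
  have h6 : B * a ^ 2 = a ^ 2 * (‖A G‖ ^ 2 / δ) + a ^ 2 * |⟪A G, G⟫_ℝ| := by rw [hB]; ring
  rw [hAh, hn]
  linarith

end LinearAlgebra

/-! ### Gaussian curvature of a level set as a function of gradient and Hessian. -/

section CurvatureOperator

variable {E : Type*} [NormedAddCommGroup E] [InnerProductSpace ℝ E]

/-- The orthogonal projection onto the orthogonal complement of `G`. -/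
def tangentProj (G : E) : E →L[ℝ] E :=
  ContinuousLinearMap.id ℝ E - (‖G‖ ^ 2)⁻¹ • (innerSL ℝ G).smulRight G

/-- The operator which is the identity on the line of `G` and, when `G` and `H` are the gradient and
the Hessian of a function, the shape operator of its level set on the complement of `G`. -/
def curvatureOperator (G : E) (H : E →L[ℝ] E) : E →L[ℝ] E :=
  ‖G‖⁻¹ • (tangentProj G ∘L H ∘L tangentProj G) + (‖G‖ ^ 2)⁻¹ • (innerSL ℝ G).smulRight G

/-- The Gaussian curvature of a level set in terms of the gradient and the Hessian. -/
def curvature (G : E) (H : E →L[ℝ] E) : ℝ := (curvatureOperator G H).det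

theorem tangentProj_apply (G v : E) :
    tangentProj G v = v - ((‖G‖ ^ 2)⁻¹ * ⟪G, v⟫_ℝ) • G := by
  simp [tangentProj, smul_smul]

theorem tangentProj_of_inner_eq_zero {G v : E} (h : ⟪G, v⟫_ℝ = 0) : tangentProj G v = v := by
  simp [tangentProj_apply, h]

theorem inner_tangentProj {G : E} (hG : G ≠ 0) (v : E) : ⟪G, tangentProj G v⟫_ℝ = 0 := by
  have : ‖G‖ ≠ 0 := norm_ne_zero_iff.2 hG
  rw [tangentProj_apply, inner_sub_right, inner_smul_right, real_inner_self_eq_norm_sq]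
  field_simp
  ring

theorem tangentProj_inner_comm (G v w : E) :
    ⟪tangentProj G v, w⟫_ℝ = ⟪v, tangentProj G w⟫_ℝ := by
  rw [tangentProj_apply, tangentProj_apply, inner_sub_left, inner_sub_right, inner_smul_left,
    inner_smul_right, real_inner_comm v G]
  simp; ring

theorem inner_curvatureOperator (G : E) (H : E →L[ℝ] E) (v w : E) :
    ⟪curvatureOperator G H v, w⟫_ℝ = ‖G‖⁻¹ * ⟪H (tangentProj G v), tangentProj G w⟫_ℝ +
      (‖G‖ ^ 2)⁻¹ * (⟪G, v⟫_ℝ * ⟪G, w⟫_ℝ) := by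
  simp [curvatureOperator, inner_add_left, inner_smul_left, tangentProj_inner_comm]

theorem inner_left_curvatureOperator {G : E} (hG : G ≠ 0) (H : E →L[ℝ] E) (v : E) :
    ⟪G, curvatureOperator G H v⟫_ℝ = ⟪G, v⟫_ℝ := by
  have : ‖G‖ ≠ 0 := norm_ne_zero_iff.2 hG
  simp only [curvatureOperator, add_apply, smul_apply,
    ContinuousLinearMap.comp_apply, inner_add_right, inner_smul_right, inner_tangentProj hG,
    ContinuousLinearMap.smulRight_apply, innerSL_apply_apply, real_inner_self_eq_norm_sq]
  field_simp
  ring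

theorem isSymmetric_curvatureOperator (G : E) {H : E →L[ℝ] E} (hH : H.toLinearMap.IsSymmetric) :
    (curvatureOperator G H).toLinearMap.IsSymmetric := by
  intro v w
  have := hH (tangentProj G v) (tangentProj G w)
  simp only [ContinuousLinearMap.coe_coe] at this ⊢
  rw [inner_curvatureOperator, real_inner_comm _ v, inner_curvatureOperator, this,
    real_inner_comm (H _)]
  ring

theorem isPositive_curvatureOperator {G : E} (hG : G ≠ 0) {H : E →L[ℝ] E}
    (hH : H.toLinearMap.IsSymmetric) (hpos : ∀ v, ⟪G, v⟫_ℝ = 0 → 0 ≤ ⟪H v, v⟫_ℝ) :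
    (curvatureOperator G H).toLinearMap.IsPositive := by
  refine ⟨isSymmetric_curvatureOperator G hH, fun v => ?_⟩
  have h1 := hpos _ (inner_tangentProj hG v)
  simp only [ContinuousLinearMap.coe_coe, RCLike.re_to_real, inner_curvatureOperator]
  have : 0 ≤ ⟪G, v⟫_ℝ * ⟪G, v⟫_ℝ := mul_self_nonneg _
  positivity

/-- Both operators agree on the line of `G`, so their difference only sees tangent vectors and the
determinant comparison applies. -/
theorem curvature_mono [FiniteDimensional ℝ E] {G : E} (hG : G ≠ 0) {H₁ H₂ : E →L[ℝ] E}
    (hH₁ : H₁.toLinearMap.IsSymmetric) (hH₂ : H₂.toLinearMap.IsSymmetric)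
    (hpos : ∀ v, ⟪G, v⟫_ℝ = 0 → 0 ≤ ⟪H₁ v, v⟫_ℝ)
    (hle : ∀ v, ⟪G, v⟫_ℝ = 0 → ⟪H₁ v, v⟫_ℝ ≤ ⟪H₂ v, v⟫_ℝ) :
    curvature G H₁ ≤ curvature G H₂ := by
  refine det_le_det_of_isPositive_sub (isPositive_curvatureOperator hG hH₁ hpos)
    ⟨(isSymmetric_curvatureOperator G hH₂).sub (isSymmetric_curvatureOperator G hH₁), fun v => ?_⟩
  have h1 := hle _ (inner_tangentProj hG v)
  have h2 : 0 ≤ ‖G‖⁻¹ := by positivity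
  have h3 := mul_le_mul_of_nonneg_left h1 h2
  simp only [LinearMap.sub_apply, ContinuousLinearMap.coe_coe, RCLike.re_to_real, inner_sub_left,
    inner_curvatureOperator]
  linarith

theorem curvature_congr [FiniteDimensional ℝ E] {G : E} (hG : G ≠ 0) {H₁ H₂ : E →L[ℝ] E}
    (hH₁ : H₁.toLinearMap.IsSymmetric) (hH₂ : H₂.toLinearMap.IsSymmetric)
    (hpos : ∀ v, ⟪G, v⟫_ℝ = 0 → 0 ≤ ⟪H₁ v, v⟫_ℝ)
    (heq : ∀ v, ⟪G, v⟫_ℝ = 0 → ⟪H₁ v, v⟫_ℝ = ⟪H₂ v, v⟫_ℝ) :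
    curvature G H₁ = curvature G H₂ :=
  le_antisymm (curvature_mono hG hH₁ hH₂ hpos fun v hv => (heq v hv).le)
    (curvature_mono hG hH₂ hH₁ (fun v hv => heq v hv ▸ hpos v hv) fun v hv => (heq v hv).ge)

theorem tangentProj_smul {c : ℝ} (hc : 0 < c) (G : E) : tangentProj (c • G) = tangentProj G := by
  ext v
  rw [tangentProj_apply, tangentProj_apply, norm_smul, Real.norm_of_nonneg hc.le, inner_smul_left,
    smul_smul]
  congr 2
  simp only [conj_trivial]
  field_simp

/-- Rescaling a defining function does not change its level set. Functions with tangent level sets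
have only proportional gradients, which this normalises. -/
theorem curvature_smul {c : ℝ} (hc : 0 < c) (G : E) (H : E →L[ℝ] E) :
    curvature (c • G) (c • H) = curvature G H := by
  have : curvatureOperator (c • G) (c • H) = curvatureOperator G H := by
    ext v
    simp only [curvatureOperator, tangentProj_smul hc, add_apply,
      smul_apply, ContinuousLinearMap.comp_apply, map_smul,
      ContinuousLinearMap.smulRight_apply, innerSL_apply_apply, norm_smul, smul_smul,
      Real.norm_of_nonneg hc.le]
    congr 2
    · field_simp
    · rw [smul_eq_mul]
      field_simp
  rw [curvature, this, curvature]

theorem continuousAt_curvature [FiniteDimensional ℝ E] {G : E} (hG : G ≠ 0) (H : E →L[ℝ] E) :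
    ContinuousAt (fun q : E × (E →L[ℝ] E) => curvature q.1 q.2) (G, H) := by
  have h0 : ‖G‖ ≠ 0 := norm_ne_zero_iff.2 hG
  have h1 : ContinuousAt (fun q : E × (E →L[ℝ] E) => ‖q.1‖⁻¹) (G, H) :=
    (continuous_fst.norm.continuousAt).inv₀ h0
  have h2 : ContinuousAt (fun q : E × (E →L[ℝ] E) => (‖q.1‖ ^ 2)⁻¹) (G, H) :=
    ((continuous_fst.norm.pow 2).continuousAt).inv₀ (pow_ne_zero 2 h0)
  have h3 : Continuous (fun q : E × (E →L[ℝ] E) => (innerSL ℝ q.1).smulRight q.1) :=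
    ((ContinuousLinearMap.smulRightL ℝ E E).continuous.comp
      ((innerSL ℝ).continuous.comp continuous_fst)).clm_apply continuous_fst
  have h4 : ContinuousAt (fun q : E × (E →L[ℝ] E) => tangentProj q.1) (G, H) :=
    continuousAt_const.sub (h2.smul h3.continuousAt)
  refine ContinuousLinearMap.continuous_det.continuousAt.comp
    ((h1.smul (h4.clm_comp (continuousAt_snd.clm_comp h4))).add (h2.smul h3.continuousAt))

/-- Uniform convexity leaves room to lower the Hessian while keeping it positive on tangent vectors.
-/
theorem exists_pos_mul_norm_sq_le_of_curvature_ne_zero [FiniteDimensional ℝ E] {G : E}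
    (hG : G ≠ 0) {H : E →L[ℝ] E} (hH : H.toLinearMap.IsSymmetric)
    (hpos : ∀ v, ⟪G, v⟫_ℝ = 0 → 0 ≤ ⟪H v, v⟫_ℝ) (hne : curvature G H ≠ 0) :
    ∃ c > 0, ∀ v, ⟪G, v⟫_ℝ = 0 → c * ‖v‖ ^ 2 ≤ ⟪H v, v⟫_ℝ := by
  obtain ⟨c, hc, h⟩ := exists_pos_mul_norm_sq_le (isPositive_curvatureOperator hG hH hpos) hne
  have h0 : 0 < ‖G‖ := norm_pos_iff.2 hG
  refine ⟨‖G‖ * c, by positivity, fun v hv => ?_⟩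
  have h1 := h v
  rw [inner_curvatureOperator, hv, tangentProj_of_inner_eq_zero hv] at h1
  have h2 := mul_le_mul_of_nonneg_left h1 h0.le
  rw [mul_zero, mul_zero, add_zero, mul_inv_cancel_left₀ h0.ne'] at h2
  linarith

end CurvatureOperator

/-! ### The shape operator in terms of gradient and Hessian. -/

section ShapeOperator

variable {n : ℕ}

/-- The Hessian operator of `f` at `p`. -/
def hessian (f : Space n → ℝ) (p : Space n) : Space n →L[ℝ] Space n := fderiv ℝ (gradient f) p

theorem contDiff_gradient {f : Space n → ℝ} (hf : ContDiff ℝ ∞ f) : ContDiff ℝ ∞ (gradient f) :=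
  (InnerProductSpace.toDual ℝ (Space n)).symm.contDiff.comp (hf.fderiv_right le_rfl)

theorem differentiable_gradient {f : Space n → ℝ} (hf : ContDiff ℝ ∞ f) :
    Differentiable ℝ (gradient f) := (contDiff_gradient hf).differentiable (by simp)

theorem continuous_hessian {f : Space n → ℝ} (hf : ContDiff ℝ ∞ f) : Continuous (hessian f) :=
  (contDiff_gradient hf).continuous_fderiv (by simp)

theorem inner_hessian {f : Space n → ℝ} (hf : ContDiff ℝ ∞ f) (p v w : Space n) :
    ⟪hessian f p v, w⟫_ℝ = fderiv ℝ (fderiv ℝ f) p v w := by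
  have h1 : (fun q => ⟪gradient f q, w⟫_ℝ) = fun q => fderiv ℝ f q w := by
    ext q; exact inner_gradient_left
  have h2 := congrArg (fun F => fderiv ℝ F p v) h1
  have h3 : Differentiable ℝ (fderiv ℝ f) :=
    (hf.fderiv_right (m := ∞) le_rfl).differentiable (by simp)
  beta_reduce at h2
  rw [fderiv_clm_apply (h3 p) (by fun_prop), fderiv_inner_apply ℝ (differentiable_gradient hf p)
    (by fun_prop)] at h2
  simpa [hessian] using h2

theorem isSymmetric_hessian {f : Space n → ℝ} (hf : ContDiff ℝ ∞ f) (p : Space n) :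
    (hessian f p).toLinearMap.IsSymmetric := by
  intro v w
  have h : IsSymmSndFDerivAt ℝ f p := hf.contDiffAt.isSymmSndFDerivAt
    (by simpa using (WithTop.coe_le_coe.2 le_top : ((2 : ℕ∞) : WithTop ℕ∞) ≤ ∞))
  simp only [ContinuousLinearMap.coe_coe]
  rw [real_inner_comm (hessian f p w), inner_hessian hf, inner_hessian hf, h.eq]

theorem mem_tangentHyperplane {f : Space n → ℝ} {p : Space n} (hG : gradient f p ≠ 0)
    {v : Space n} : v ∈ tangentHyperplane (outwardNormal f) p ↔ ⟪gradient f p, v⟫_ℝ = 0 := by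
  rw [Submodule.mem_orthogonal_singleton_iff_inner_right, outwardNormal, inner_smul_left]
  simp [hG]

theorem finrank_tangentHyperplane {f : Space n → ℝ} {p : Space n} (hG : gradient f p ≠ 0) :
    Module.finrank ℝ (tangentHyperplane (outwardNormal f) p) = n := by
  have : Fact (Module.finrank ℝ (Space n) = n + 1) := ⟨by simp⟩
  refine Submodule.finrank_orthogonal_span_singleton ?_
  simp [outwardNormal, hG]

/-- Differentiating the factor `‖gradient f‖⁻¹` only produces a multiple of the gradient, which is
orthogonal to `w`. -/
theorem inner_shapeOperator {f : Space n → ℝ} (hf : ContDiff ℝ ∞ f) {p : Space n}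
    (hG : gradient f p ≠ 0) (v w : tangentHyperplane (outwardNormal f) p) :
    ⟪shapeOperator (outwardNormal f) p v, w⟫_ℝ =
      ‖gradient f p‖⁻¹ * ⟪hessian f p v, (w : Space n)⟫_ℝ := by
  have h1 : DifferentiableAt ℝ (fun q => ‖gradient f q‖⁻¹) p :=
    (((differentiable_gradient hf) p).norm ℝ hG).inv (norm_ne_zero_iff.2 hG)
  have h2 := h1.hasFDerivAt.smul ((differentiable_gradient hf) p).hasFDerivAt
  have h3 : fderiv ℝ (outwardNormal f) p = _ := h2.fderiv
  have hw := (mem_tangentHyperplane hG).1 w.2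
  have : ⟪shapeOperator (outwardNormal f) p v, w⟫_ℝ
      = ⟪fderiv ℝ (outwardNormal f) p v, (w : Space n)⟫_ℝ := by
    simp only [shapeOperator, ContinuousLinearMap.coe_coe, ContinuousLinearMap.comp_apply,
      Submodule.subtypeL_apply]
    exact Submodule.inner_orthogonalProjectionOnto_eq_of_mem_right w _
  rw [this, h3]
  simp [inner_add_left, inner_smul_left, hw, hessian]

/-- The curvature operator preserves the tangent hyperplane, restricts there to the shape operator
and induces the identity on the quotient line, so its determinant is that of the shape operator. -/
theorem gaussCurvature_eq {f : Space n → ℝ} (hf : ContDiff ℝ ∞ f) {p : Space n}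
    (hG : gradient f p ≠ 0) : gaussCurvature f p = curvature (gradient f p) (hessian f p) := by
  set M := curvatureOperator (gradient f p) (hessian f p) with hM
  set T := tangentHyperplane (outwardNormal f) p with hT
  have hle : T ≤ T.comap M.toLinearMap := fun v hv => by
    rw [Submodule.mem_comap, ContinuousLinearMap.coe_coe, mem_tangentHyperplane hG,
      inner_left_curvatureOperator hG]
    exact (mem_tangentHyperplane hG).1 hv
  have hdet := LinearMap.det_eq_det_mul_det T M.toLinearMap hle
  have hq : T.mapQ T M.toLinearMap hle = LinearMap.id := by
    apply Submodule.linearMap_qext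
    ext v
    simp only [LinearMap.comp_apply, Submodule.mkQ_apply, Submodule.mapQ_apply, LinearMap.id_apply]
    rw [Submodule.Quotient.eq, mem_tangentHyperplane hG, inner_sub_right]
    exact sub_eq_zero.2 (inner_left_curvatureOperator hG _ v)
  have hr : M.toLinearMap.restrict hle = shapeOperator (outwardNormal f) p := by
    ext1 v
    refine ext_inner_right ℝ fun w => ?_
    rw [inner_shapeOperator hf hG]
    have hv := (mem_tangentHyperplane hG).1 v.2
    have hw := (mem_tangentHyperplane hG).1 w.2
    change ⟪M v, (w : Space n)⟫_ℝ = _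
    rw [hM, inner_curvatureOperator, hv, tangentProj_of_inner_eq_zero hv,
      tangentProj_of_inner_eq_zero hw]
    simp
  rw [hq, LinearMap.det_id, mul_one, hr] at hdet
  exact hdet.symm

theorem isPositive_shapeOperator_iff {f : Space n → ℝ} (hf : ContDiff ℝ ∞ f) {p : Space n}
    (hG : gradient f p ≠ 0) : (shapeOperator (outwardNormal f) p).IsPositive ↔
      ∀ v, ⟪gradient f p, v⟫_ℝ = 0 → 0 ≤ ⟪hessian f p v, v⟫_ℝ := by
  have h0 : 0 < ‖gradient f p‖⁻¹ := inv_pos.2 (norm_pos_iff.2 hG)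
  constructor
  · intro h v hv
    have := h.2 ⟨v, (mem_tangentHyperplane hG).2 hv⟩
    rw [RCLike.re_to_real, inner_shapeOperator hf hG] at this
    exact nonneg_of_mul_nonneg_right this h0
  · refine fun h => ⟨fun v w => ?_, fun v => ?_⟩
    · rw [real_inner_comm (shapeOperator _ _ w), inner_shapeOperator hf hG,
        inner_shapeOperator hf hG, real_inner_comm _ (hessian f p w)]
      exact congrArg _ (isSymmetric_hessian hf p v w)
    · rw [RCLike.re_to_real, inner_shapeOperator hf hG]
      exact mul_nonneg h0.le (h v ((mem_tangentHyperplane hG).1 v.2))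

theorem shapeOperatorIn_detSet_iff {f : Space n → ℝ} (hf : ContDiff ℝ ∞ f) {p : Space n}
    (hG : gradient f p ≠ 0) {t : ℝ} : ShapeOperatorIn (detSet n t) (outwardNormal f) p ↔
      (∀ v, ⟪gradient f p, v⟫_ℝ = 0 → 0 ≤ ⟪hessian f p v, v⟫_ℝ) ∧
        t ≤ curvature (gradient f p) (hessian f p) := by
  rw [← isPositive_shapeOperator_iff hf hG, ← gaussCurvature_eq hf hG, gaussCurvature]
  constructor
  · rintro ⟨b, A, ⟨hA, hdet⟩, heq⟩
    rw [← heq] at hA hdet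
    rw [LinearMap.det_toMatrix] at hdet
    exact ⟨(LinearMap.posSemidef_toMatrix_iff b).1 hA, hdet⟩
  · rintro ⟨h1, h2⟩
    let b := (stdOrthonormalBasis ℝ (tangentHyperplane (outwardNormal f) p)).reindex
      (finCongr (finrank_tangentHyperplane hG))
    have hA := (LinearMap.posSemidef_toMatrix_iff b).2 h1
    refine ⟨b, ⟨_, (by simpa using hA.1 : Matrix.IsSymm _)⟩, ⟨hA, ?_⟩, rfl⟩
    rwa [LinearMap.det_toMatrix]

/-- Only the case of determinant exactly `t` needs an argument: there `A` is the limit of `s • A` as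
`s ↑ 1`, whose determinant `s ^ n * t` is below `t` since `n ≥ 1` and `t > 0`. -/
theorem mem_closure_compl_detSet (hn : 1 ≤ n) {t : ℝ} (ht : 0 < t) {A : SymmMatrix n}
    (hA : A.1.PosSemidef → A.1.det ≤ t) : A ∈ closure (detSet n t)ᶜ := by
  by_cases hAF : A ∈ detSet n t
  swap
  · exact subset_closure hAF
  have hdet : A.1.det = t := le_antisymm (hA hAF.1) hAF.2
  let B : ℝ → SymmMatrix n := fun s => ⟨s • A.1, A.2.smul s⟩
  have hB : Continuous B := by
    refine Continuous.subtype_mk ?_ _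
    fun_prop
  have hB1 : B 1 = A := Subtype.ext (one_smul ℝ _)
  have hlim : Tendsto B (𝓝[Ioo 0 1] 1) (𝓝 A) := hB1 ▸ (hB.tendsto 1).mono_left inf_le_left
  have : (𝓝[Ioo (0 : ℝ) 1] 1).NeBot := by
    rw [← mem_closure_iff_nhdsWithin_neBot, closure_Ioo zero_ne_one]
    simp
  refine mem_closure_of_tendsto hlim ?_
  filter_upwards [self_mem_nhdsWithin] with s hs hmem
  have h1 : t ≤ (s • A.1).det := hmem.2
  rw [Matrix.det_smul, hdet, Fintype.card_fin] at h1
  have h2 : s ^ n < 1 := pow_lt_one₀ hs.1.le hs.2 (by omega)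
  nlinarith

theorem shapeOperatorIn_closure_compl_detSet (hn : 1 ≤ n) {f : Space n → ℝ} (hf : ContDiff ℝ ∞ f)
    {p : Space n} (hG : gradient f p ≠ 0) {t : ℝ} (ht : 0 < t)
    (h : (∀ v, ⟪gradient f p, v⟫_ℝ = 0 → 0 ≤ ⟪hessian f p v, v⟫_ℝ) →
      curvature (gradient f p) (hessian f p) ≤ t) :
    ShapeOperatorIn (closure (detSet n t)ᶜ) (outwardNormal f) p := by
  rw [← isPositive_shapeOperator_iff hf hG, ← gaussCurvature_eq hf hG, gaussCurvature] at h
  let b := (stdOrthonormalBasis ℝ (tangentHyperplane (outwardNormal f) p)).reindex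
    (finCongr (finrank_tangentHyperplane hG))
  have hsymm : (shapeOperator (outwardNormal f) p).IsSymmetric := fun v w => by
    rw [real_inner_comm (shapeOperator _ _ w), inner_shapeOperator hf hG,
      inner_shapeOperator hf hG, real_inner_comm _ (hessian f p w)]
    exact congrArg _ (isSymmetric_hessian hf p v w)
  have hA :
      (LinearMap.toMatrix b.toBasis b.toBasis (shapeOperator (outwardNormal f) p)).IsSymm := by
    ext i j
    simp only [Matrix.transpose_apply, LinearMap.toMatrix_apply, OrthonormalBasis.coe_toBasis,
      OrthonormalBasis.coe_toBasis_repr_apply, OrthonormalBasis.repr_apply_apply]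
    rw [← hsymm, real_inner_comm]
  refine ⟨b, ⟨_, hA⟩, mem_closure_compl_detSet hn ht fun hps => ?_, rfl⟩
  rw [LinearMap.det_toMatrix]
  exact h ((LinearMap.posSemidef_toMatrix_iff b).1 hps)

end ShapeOperator

theorem tendsto_nhdsGT_zero {F : Type*} [TopologicalSpace F] {φ : ℝ → F} (hφ : Continuous φ) {y : F}
    (hy : φ 0 = y) : Tendsto φ (𝓝[>] 0) (𝓝 y) :=
  hy ▸ (hφ.tendsto 0).mono_left inf_le_left

/-! ### Quadratic functions, Taylor expansion and second order comparison. -/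

section Quadratic

variable {n : ℕ}

/-- The quadratic function with value `c`, gradient `G` and Hessian `A` at `p`. -/
def quadratic (p : Space n) (c : ℝ) (G : Space n) (A : Space n →L[ℝ] Space n) (x : Space n) : ℝ :=
  c + ⟪G, x - p⟫_ℝ + 2⁻¹ * ⟪A (x - p), x - p⟫_ℝ

variable {p G : Space n} {c : ℝ} {A : Space n →L[ℝ] Space n}

theorem quadratic_self : quadratic p c G A p = c := by simp [quadratic]

theorem contDiff_quadratic : ContDiff ℝ ∞ (quadratic p c G A) := by
  unfold quadratic
  have : ContDiff ℝ ∞ fun x : Space n => x - p := contDiff_id.sub contDiff_const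
  exact (contDiff_const.add (contDiff_const.inner ℝ this)).add
    (contDiff_const.mul ((A.contDiff.comp this).inner ℝ this))

theorem quadratic_eq (hA : A.toLinearMap.IsSymmetric) (x y : Space n) :
    quadratic p c G A y =
      quadratic p c G A x + ⟪G + A (x - p), y - x⟫_ℝ + 2⁻¹ * ⟪A (y - x), y - x⟫_ℝ := by
  obtain ⟨u, rfl⟩ : ∃ u, x = p + u := ⟨x - p, by abel⟩
  obtain ⟨w, rfl⟩ : ∃ w, y = p + u + w := ⟨y - (p + u), by abel⟩
  have h1 : p + u + w - p = u + w := by abel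
  have h2 : p + u + w - (p + u) = w := by abel
  have h3 : ⟪A w, u⟫_ℝ = ⟪A u, w⟫_ℝ := by
    rw [real_inner_comm]; exact (hA u w).symm
  simp only [quadratic, h1, h2, add_sub_cancel_left, map_add, inner_add_left, inner_add_right, h3]
  ring

theorem hasFDerivAt_quadratic (hA : A.toLinearMap.IsSymmetric) (x : Space n) :
    HasFDerivAt (quadratic p c G A) (innerSL ℝ (G + A (x - p))) x := by
  have h1 : HasFDerivAt (fun x : Space n => x - p) (ContinuousLinearMap.id ℝ _) x :=
    (hasFDerivAt_id x).sub_const p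
  have h2 : HasFDerivAt (fun x : Space n => A (x - p)) A x := by
    exact A.hasFDerivAt.comp x h1
  have h3 := ((hasFDerivAt_const c x).add ((hasFDerivAt_const G x).inner ℝ h1)).add
    ((h2.inner ℝ h1).const_mul (2⁻¹ : ℝ))
  refine h3.congr_fderiv ?_
  ext v
  have : ⟪A v, x - p⟫_ℝ = ⟪A (x - p), v⟫_ℝ := by
    rw [real_inner_comm]; exact (hA _ _).symm
  simp only [add_apply, smul_apply, ContinuousLinearMap.comp_apply, ContinuousLinearMap.prod_apply,
    fderivInnerCLM_apply, ContinuousLinearMap.id_apply, zero_apply, inner_zero_left, this,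
    innerSL_apply_apply, inner_add_left, smul_eq_mul]
  ring

theorem gradient_quadratic (hA : A.toLinearMap.IsSymmetric) :
    gradient (quadratic p c G A) = fun x => G + A (x - p) := by
  refine gradient_eq fun x => ?_
  exact hasGradientAt_iff_hasFDerivAt.2 (hasFDerivAt_quadratic hA x)

theorem hessian_quadratic (hA : A.toLinearMap.IsSymmetric) (x : Space n) :
    hessian (quadratic p c G A) x = A := by
  rw [hessian, gradient_quadratic hA]
  have h1 : HasFDerivAt (fun x : Space n => x - p) (ContinuousLinearMap.id ℝ _) x :=
    (hasFDerivAt_id x).sub_const p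
  have h2 : HasFDerivAt (fun x : Space n => G + A (x - p)) A x := by
    simpa using (A.hasFDerivAt.comp x h1).const_add G
  exact h2.fderiv

theorem convexOn_quadratic (hA : A.toLinearMap.IsSymmetric) (hpos : ∀ v, 0 ≤ ⟪A v, v⟫_ℝ) :
    ConvexOn ℝ univ (quadratic p c G A) := by
  refine ⟨convex_univ, fun x _ y _ a b ha hb hab => ?_⟩
  set z := a • x + b • y with hz
  have hx := quadratic_eq (p := p) (c := c) (G := G) hA z x
  have hy := quadratic_eq (p := p) (c := c) (G := G) hA z y
  have h1 := hpos (x - z)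
  have h2 := hpos (y - z)
  have h3 : a * ⟪G + A (z - p), x - z⟫_ℝ + b * ⟪G + A (z - p), y - z⟫_ℝ = 0 := by
    rw [← inner_smul_right, ← inner_smul_right, ← inner_add_right]
    have : a • (x - z) + b • (y - z) = 0 := by
      rw [smul_sub, smul_sub, sub_add_sub_comm, ← hz, ← add_smul, hab, one_smul, sub_self]
    rw [this, inner_zero_right]
  rw [smul_eq_mul, smul_eq_mul, hx, hy]
  have h4 : quadratic p c G A z = a * quadratic p c G A z + b * quadratic p c G A z := by
    rw [← add_mul, hab, one_mul]
  nlinarith [mul_nonneg ha h1, mul_nonneg hb h2]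

/-- Second order Taylor expansion. -/
theorem taylor_isLittleO {f : Space n → ℝ} (hf : ContDiff ℝ ∞ f) (p : Space n) :
    (fun x => f x - quadratic p (f p) (gradient f p) (hessian f p) x) =o[𝓝 p]
      fun x => ‖x - p‖ ^ 2 := by
  rw [Asymptotics.isLittleO_iff]
  intro ε hε
  have h1 := ((differentiable_gradient hf) p).hasFDerivAt.isLittleO.def hε
  obtain ⟨r, hr, hball⟩ := Metric.eventually_nhds_iff_ball.1 h1
  filter_upwards [Metric.ball_mem_nhds p hr] with x hx
  -- Mean value inequality on the ball of radius `‖x - p‖`, where the gradient of the remainder is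
  -- at most `ε ‖x - p‖`.
  have hd : ∀ y ∈ Metric.closedBall p ‖x - p‖, HasFDerivWithinAt
      (fun x => f x - quadratic p (f p) (gradient f p) (hessian f p) x)
      (innerSL ℝ (gradient f y - gradient f p - hessian f p (y - p)))
      (Metric.closedBall p ‖x - p‖) y := fun y _ => by
    have h2 : HasFDerivAt f (innerSL ℝ (gradient f y)) y :=
      hasGradientAt_iff_hasFDerivAt.1 ((hf.differentiable (by simp)) y).hasGradientAt
    refine ((h2.sub (hasFDerivAt_quadratic (isSymmetric_hessian hf p) y)).congr_fderiv
      ?_).hasFDerivWithinAt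
    rw [← map_sub, sub_add_eq_sub_sub]
  have hb : ∀ y ∈ Metric.closedBall p ‖x - p‖,
      ‖innerSL ℝ (gradient f y - gradient f p - hessian f p (y - p))‖ ≤ ε * ‖x - p‖ :=
    fun y hy => by
      rw [innerSL_apply_norm]
      rw [mem_closedBall_iff_norm] at hy
      refine (hball y ?_).trans (by gcongr)
      rw [mem_ball_iff_norm] at hx ⊢
      exact hy.trans_lt hx
  have := (convex_closedBall p ‖x - p‖).norm_image_sub_le_of_norm_hasFDerivWithin_le hd hb
    (Metric.mem_closedBall_self (norm_nonneg _)) (y := x) (by simp [dist_eq_norm])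
  simp only [quadratic_self, sub_self, sub_zero] at this
  refine this.trans_eq ?_
  rw [norm_pow, norm_norm]
  ring

/-- Along the parabola `p + s v + s² w` with `v` tangent, the first order effect of `w` and the
second order effect of `v` have the same size `s²`. -/
theorem tendsto_div_sq {f : Space n → ℝ} (hf : ContDiff ℝ ∞ f) {p : Space n} (hp : f p = 0)
    {v : Space n} (hv : ⟪gradient f p, v⟫_ℝ = 0) (w : Space n) :
    Tendsto (fun s : ℝ => f (p + s • (v + s • w)) / s ^ 2) (𝓝[>] 0)
      (𝓝 (⟪gradient f p, w⟫_ℝ + 2⁻¹ * ⟪hessian f p v, v⟫_ℝ)) := by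
  have hc : Tendsto (fun s : ℝ => p + s • (v + s • w)) (𝓝[>] 0) (𝓝 p) := 
      tendsto_nhdsGT_zero (by fun_prop) (by simp)
  have h1 := (taylor_isLittleO hf p).comp_tendsto hc
  have h2 : (fun s : ℝ => ‖p + s • (v + s • w) - p‖ ^ 2) =O[𝓝[>] 0] fun s : ℝ => s ^ 2 := by
    have : (fun s : ℝ => p + s • (v + s • w) - p) =O[𝓝[>] 0] fun s : ℝ => s := by
      have h3 : (fun s : ℝ => v + s • w) =O[𝓝[>] 0] fun _ : ℝ => (1 : ℝ) := by
        exact (tendsto_nhdsGT_zero (by fun_prop) rfl).isBigO_one ℝ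
      simpa using (Asymptotics.isBigO_refl (fun s : ℝ => s) (𝓝[>] 0)).smul h3
    exact this.norm_left.pow 2
  have h4 := (h1.trans_isBigO h2).tendsto_div_nhds_zero
  have h5 : Tendsto (fun s : ℝ => ⟪gradient f p, w⟫_ℝ +
      2⁻¹ * ⟪hessian f p (v + s • w), v + s • w⟫_ℝ) (𝓝[>] 0)
      (𝓝 (⟪gradient f p, w⟫_ℝ + 2⁻¹ * ⟪hessian f p v, v⟫_ℝ)) := 
      tendsto_nhdsGT_zero (by fun_prop) (by simp)
  have h6 := h4.add h5
  rw [zero_add] at h6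
  refine h6.congr' ?_
  filter_upwards [self_mem_nhdsWithin] with s hs
  have hs0 : s ≠ 0 := (show (0 : ℝ) < s from hs).ne'
  have h7 : ⟪gradient f p, v + s • w⟫_ℝ = s * ⟪gradient f p, w⟫_ℝ := by
    rw [inner_add_right, hv, inner_smul_right, zero_add]
  rw [Function.comp_apply, quadratic, add_sub_cancel_left, hp, map_smul, inner_smul_right, h7,
    real_inner_smul_left, real_inner_smul_right]
  field_simp
  ring

/-- The comparison principle to second order for tangent hypersurfaces. -/
theorem comparison {f g : Space n → ℝ} (hf : ContDiff ℝ ∞ f) (hg : ContDiff ℝ ∞ g) {p : Space n}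
    (hfp : f p = 0) (hgp : g p = 0) (hfG : gradient f p ≠ 0) (hgG : gradient g p ≠ 0)
    (hle : ∀ᶠ x in 𝓝 p, f x < 0 → g x ≤ 0) :
    ∃ c : ℝ, 0 < c ∧ gradient g p = c • gradient f p ∧
      ∀ v, ⟪gradient f p, v⟫_ℝ = 0 → ⟪hessian g p v, v⟫_ℝ ≤ c * ⟪hessian f p v, v⟫_ℝ := by
  -- If the `s²` coefficient of `f` along the parabola is negative, then `f < 0` for small `s`,
  -- hence `g ≤ 0` there and the coefficient of `g` is nonpositive.
  have key : ∀ v w, ⟪gradient f p, v⟫_ℝ = 0 → ⟪gradient g p, v⟫_ℝ = 0 →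
      ⟪gradient f p, w⟫_ℝ + 2⁻¹ * ⟪hessian f p v, v⟫_ℝ < 0 →
      ⟪gradient g p, w⟫_ℝ + 2⁻¹ * ⟪hessian g p v, v⟫_ℝ ≤ 0 := by
    intro v w h1 h2 h3
    have hc : Tendsto (fun s : ℝ => p + s • (v + s • w)) (𝓝[>] 0) (𝓝 p) := 
      tendsto_nhdsGT_zero (by fun_prop) (by simp)
    refine le_of_tendsto (tendsto_div_sq hg hgp h2 w) ?_
    filter_upwards [(tendsto_div_sq hf hfp h1 w).eventually_lt_const h3, hc.eventually hle,
      self_mem_nhdsWithin] with s hs1 hs2 hs3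
    have hs : 0 < s ^ 2 := pow_pos hs3 2
    refine div_nonpos_of_nonpos_of_nonneg (hs2 ?_) hs.le
    exact (div_neg_iff.1 hs1).elim (fun h => absurd h.2 hs.le.not_gt) fun h => h.1
  set a := gradient f p
  set b := gradient g p
  -- The case `v = 0` is an inclusion of half-spaces, which makes `b` a positive multiple of `a`.
  have h1 : ∀ w, ⟪a, w⟫_ℝ < 0 → ⟪b, w⟫_ℝ ≤ 0 := fun w hw => by
    simpa using key 0 w (by simp) (by simp) (by simpa using hw)
  have ha2 : 0 < ‖a‖ ^ 2 := pow_pos (norm_pos_iff.2 hfG) 2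
  have h2 : ∀ w, ⟪a, w⟫_ℝ ≤ 0 → ⟪b, w⟫_ℝ ≤ 0 := fun w hw => by
    have hlim : Tendsto (fun s : ℝ => ⟪b, w - s • a⟫_ℝ) (𝓝[>] 0) (𝓝 ⟪b, w⟫_ℝ) := 
      tendsto_nhdsGT_zero (by fun_prop) (by simp)
    refine le_of_tendsto hlim ?_
    filter_upwards [self_mem_nhdsWithin] with s hs
    apply h1
    rw [inner_sub_right, inner_smul_right, real_inner_self_eq_norm_sq]
    have : 0 < s * ‖a‖ ^ 2 := mul_pos hs ha2
    linarith
  set c := ⟪a, b⟫_ℝ / ‖a‖ ^ 2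
  have hac : ⟪a, b - c • a⟫_ℝ = 0 := by
    rw [inner_sub_right, inner_smul_right, real_inner_self_eq_norm_sq]
    simp only [c]
    field_simp
    ring
  have hbc : b = c • a := by
    have h3 := h2 _ hac.le
    have h4 : ⟪b, b - c • a⟫_ℝ = ‖b - c • a‖ ^ 2 := by
      rw [← real_inner_self_eq_norm_sq, inner_sub_left b, inner_smul_left, hac]
      simp
    rw [h4] at h3
    have : ‖b - c • a‖ = 0 := by nlinarith [norm_nonneg (b - c • a)]
    exact sub_eq_zero.1 (norm_eq_zero.1 this)
  have hc : 0 < c := by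
    have h3 := h2 (-a) (by rw [inner_neg_right, real_inner_self_eq_norm_sq]; linarith)
    rw [hbc, inner_neg_right, inner_smul_left, real_inner_self_eq_norm_sq, conj_trivial] at h3
    have h4 : c ≠ 0 := fun h => hgG (by rw [hbc, h, zero_smul])
    have h5 : 0 ≤ c := nonneg_of_mul_nonneg_left (by linarith) ha2
    exact lt_of_le_of_ne h5 h4.symm
  refine ⟨c, hc, hbc, fun v hv => ?_⟩
  have hbv : ⟪b, v⟫_ℝ = 0 := by rw [hbc, inner_smul_left, hv, mul_zero]
  refine le_of_forall_pos_le_add fun ε hε => ?_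
  -- The normal displacement `-μ` just outweighs the Hessian of `f` in direction `v`. The excess `ε
  -- / (2 * c)` becomes `ε` after multiplication by `2 * c`.
  set μ := 2⁻¹ * ⟪hessian f p v, v⟫_ℝ + ε / (2 * c)
  have haw : ⟪a, (-(μ / ‖a‖ ^ 2)) • a⟫_ℝ = -μ := by
    rw [inner_smul_right, real_inner_self_eq_norm_sq]
    field_simp
  have hε' : 0 < ε / (2 * c) := by positivity
  have h3 := key v ((-(μ / ‖a‖ ^ 2)) • a) hv hbv (by rw [haw]; simp only [μ]; linarith)
  rw [hbc, inner_smul_left, haw, conj_trivial] at h3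
  have h4 : c * μ = 2⁻¹ * (c * ⟪hessian f p v, v⟫_ℝ) + ε / 2 := by
    simp only [μ]; field_simp
  linarith

theorem curvature_le_of_comparison {f g : Space n → ℝ} (hf : ContDiff ℝ ∞ f) (hg : ContDiff ℝ ∞ g)
    {p : Space n} (hfp : f p = 0) (hgp : g p = 0) (hfG : gradient f p ≠ 0)
    (hgG : gradient g p ≠ 0) (hle : ∀ᶠ x in 𝓝 p, f x < 0 → g x ≤ 0)
    (hpos : ∀ v, ⟪gradient g p, v⟫_ℝ = 0 → 0 ≤ ⟪hessian g p v, v⟫_ℝ) :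
    (∀ v, ⟪gradient f p, v⟫_ℝ = 0 → 0 ≤ ⟪hessian f p v, v⟫_ℝ) ∧
      curvature (gradient g p) (hessian g p) ≤ curvature (gradient f p) (hessian f p) := by
  obtain ⟨c, hc, hG, hH⟩ := comparison hf hg hfp hgp hfG hgG hle
  have hiff : ∀ v, ⟪gradient g p, v⟫_ℝ = 0 ↔ ⟪gradient f p, v⟫_ℝ = 0 := fun v => by
    rw [hG, inner_smul_left]; simp [hc.ne']
  refine ⟨fun v hv => ?_, ?_⟩
  · exact nonneg_of_mul_nonneg_right ((hpos v ((hiff v).2 hv)).trans (hH v hv)) hc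
  · rw [← curvature_smul hc (gradient f p), ← hG]
    refine curvature_mono hgG (isSymmetric_hessian hg p)
      ((isSymmetric_hessian hf p).smul (by simp)) hpos fun v hv => ?_
    simpa [inner_smul_left] using hH v ((hiff v).1 hv)

theorem mem_closure_lt_of_gradient_ne_zero {f : Space n → ℝ} (hf : ContDiff ℝ ∞ f) {p : Space n}
    (hG : gradient f p ≠ 0) : p ∈ closure {x | f x < f p} := by
  have h := tendsto_div_sq (f := fun x => f x - f p) (hf.sub contDiff_const) (sub_self _) (v := 0)
    (inner_zero_right _) (-gradient f p)
  have hgrad : gradient (fun x => f x - f p) p = gradient f p := by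
    simp only [gradient, fderiv_sub_const]
  have hc : Tendsto (fun s : ℝ => p + s • (0 + s • -gradient f p)) (𝓝[>] 0) (𝓝 p) := 
      tendsto_nhdsGT_zero (by fun_prop) (by simp)
  refine mem_closure_of_tendsto hc ?_
  have hneg : ⟪gradient (fun x => f x - f p) p, -gradient f p⟫_ℝ +
      2⁻¹ * ⟪hessian (fun x => f x - f p) p 0, 0⟫_ℝ < 0 := by
    rw [hgrad, inner_neg_right, real_inner_self_eq_norm_sq, inner_zero_right]
    have := pow_pos (norm_pos_iff.2 hG) 2
    linarith
  filter_upwards [h.eventually_lt_const hneg, self_mem_nhdsWithin] with s hs1 hs3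
  have hs : 0 < s ^ 2 := pow_pos hs3 2
  have := (div_neg_iff.1 hs1).elim (fun h => absurd h.2 hs.le.not_gt) fun h => h.1
  simpa using this

/-- The second fundamental form is nonnegative where a hypersurface touches the boundary of a convex
set from inside. -/
theorem hessian_nonneg_of_convex {X : Set (Space n)} (hX : Convex ℝ X) {f : Space n → ℝ}
    (hf : ContDiff ℝ ∞ f) {p : Space n} (hp : p ∉ interior X) (hfp : f p = 0)
    (hG : gradient f p ≠ 0) (hle : ∀ᶠ x in 𝓝 p, f x < 0 → x ∈ interior X) (v : Space n)
    (hv : ⟪gradient f p, v⟫_ℝ = 0) : 0 ≤ ⟪hessian f p v, v⟫_ℝ := by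
  obtain ⟨l, hl⟩ := geometric_hahn_banach_open_point hX.interior isOpen_interior hp
  have hfreq := mem_closure_iff_frequently.1 (mem_closure_lt_of_gradient_ne_zero hf hG)
  obtain ⟨x₀, hx₀, hx₀'⟩ := (hfreq.and_eventually hle).exists
  rw [mem_ofPred_eq, hfp] at hx₀
  have hlx₀ := hl x₀ (hx₀' hx₀)
  set ν := (InnerProductSpace.toDual ℝ (Space n)).symm l with hν
  have hνl : ∀ x, ⟪ν, x⟫_ℝ = l x := fun x => InnerProductSpace.toDual_symm_apply
  have h0 : (0 : Space n →L[ℝ] Space n).toLinearMap.IsSymmetric := fun _ _ => by simp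
  have hν0 : ν ≠ 0 := fun h => by
    have h1 := hνl x₀
    have h2 := hνl p
    rw [h, inner_zero_left] at h1 h2
    linarith
  -- The supporting hyperplane at `p` is treated as a quadric with zero Hessian and compared with
  -- `f`.
  have hgrad : gradient (quadratic p 0 ν 0) p = ν := by simp [gradient_quadratic h0]
  obtain ⟨c, hc, -, h⟩ := comparison hf (contDiff_quadratic (p := p) (c := 0) (G := ν) (A := 0))
    hfp quadratic_self hG (by rwa [hgrad]) (by
      filter_upwards [hle] with x hx hfx
      have := hl x (hx hfx)
      simp only [quadratic, hνl, zero_apply, inner_zero_left]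
      rw [map_sub]
      linarith)
  have := h v hv
  rw [hessian_quadratic h0] at this
  simp only [zero_apply, inner_zero_left] at this
  exact nonneg_of_mul_nonneg_right this hc

end Quadratic

/-! ### Testing the type by functions and by ellipsoids. -/

section Types

variable {n : ℕ} {X U : Set (Space n)} {p : Space n} {f : Space n → ℝ} {t : ℝ}

theorem IsDefiningFunction.apply_eq_zero (hf : IsDefiningFunction U p f) (hp : p ∈ frontier U) :
    f p = 0 := by
  have h1 := hf.interior_iff.self_of_nhds
  have h2 := hf.closure_iff.self_of_nhds
  exact le_antisymm (h2.1 hp.1) (not_lt.1 fun h => hp.2 (h1.2 h))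

/-- At `p` the level set of `f` has a nonnegative second fundamental form and Gaussian curvature at
least `t`. -/
def CurvatureAtLeast (t : ℝ) (f : Space n → ℝ) (p : Space n) : Prop :=
  (∀ v, ⟪gradient f p, v⟫_ℝ = 0 → 0 ≤ ⟪hessian f p v, v⟫_ℝ) ∧
    t ≤ curvature (gradient f p) (hessian f p)

/-- Replaces the open set `U` by the germ of a touching function. For convex `X` the converse is
`curvatureAtLeast_of_isOfType`. -/
theorem isOfType_of_forall {W : Set (Space n)}
    (h : ∀ p ∈ frontier X ∩ W, ∀ f : Space n → ℝ, ContDiff ℝ ∞ f → gradient f p ≠ 0 → f p = 0 →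
      (∀ᶠ x in 𝓝 p, f x < 0 → x ∈ interior X) → CurvatureAtLeast t f p) :
    IsOfType (detSet n t) X W := by
  intro p hp U hU hUX _ hpU f hf
  refine (shapeOperatorIn_detSet_iff hf.smooth hf.gradient_ne_zero).2
    (h p hp f hf.smooth hf.gradient_ne_zero (hf.apply_eq_zero hpU) ?_)
  filter_upwards [hf.interior_iff] with x hx hfx
  have := hx.2 hfx
  rw [hU.interior_eq] at this
  exact hUX this

theorem CurvatureAtLeast.of_le {g : Space n → ℝ} (hg : CurvatureAtLeast t g p)
    (hfs : ContDiff ℝ ∞ f) (hgs : ContDiff ℝ ∞ g) (hfp : f p = 0) (hgp : g p = 0)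
    (hfG : gradient f p ≠ 0) (hgG : gradient g p ≠ 0) (hle : ∀ᶠ x in 𝓝 p, f x < 0 → g x ≤ 0) :
    CurvatureAtLeast t f p := by
  have := curvature_le_of_comparison hfs hgs hfp hgp hfG hgG hle hg.1
  exact ⟨this.1, hg.2.trans this.2⟩

variable {G : Space n} {A : Space n →L[ℝ] Space n}

/-- A critical point of this convex function would be a minimum, but `c` is not the minimal value
because the gradient `G` at `p` is nonzero. -/
theorem gradient_quadratic_ne_zero (hA : A.toLinearMap.IsSymmetric) (hpos : ∀ v, 0 ≤ ⟪A v, v⟫_ℝ)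
    (hG : G ≠ 0) {x : Space n} {c : ℝ} (hx : quadratic p c G A x = c) :
    gradient (quadratic p c G A) x ≠ 0 := by
  intro h
  obtain ⟨y, hy⟩ : ∃ y, quadratic p c G A y < c := by
    have h1 : gradient (quadratic p c G A) p ≠ 0 := by simpa [gradient_quadratic hA]
    obtain ⟨y, hy⟩ := (mem_closure_iff_frequently.1
      (mem_closure_lt_of_gradient_ne_zero contDiff_quadratic h1)).exists
    exact ⟨y, by simpa [quadratic_self] using hy⟩
  rw [gradient_quadratic hA] at h
  beta_reduce at h
  rw [quadratic_eq hA x y, hx, h, inner_zero_left] at hy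
  have := hpos (y - x)
  linarith

theorem isDefiningFunction_quadratic (hA : A.toLinearMap.IsSymmetric)
    (hpos : ∀ v, 0 ≤ ⟪A v, v⟫_ℝ) (hG : G ≠ 0) {x : Space n} (hx : quadratic p 0 G A x = 0) :
    IsDefiningFunction {y | quadratic p 0 G A y < 0} x (quadratic p 0 G A) := by
  have hcont : Continuous (quadratic p 0 G A) := contDiff_quadratic.continuous
  have hopen : IsOpen {y | quadratic p 0 G A y < 0} := isOpen_lt hcont continuous_const
  refine ⟨contDiff_quadratic, gradient_quadratic_ne_zero hA hpos hG hx, .of_forall fun y => ?_,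
    .of_forall fun y => ⟨fun h => closure_lt_subset_le hcont continuous_const h, fun h => ?_⟩⟩
  · rw [hopen.interior_eq]; rfl
  · rcases h.lt_or_eq with h | h
    · exact subset_closure h
    · have := mem_closure_lt_of_gradient_ne_zero contDiff_quadratic
        (gradient_quadratic_ne_zero hA hpos hG h)
      rwa [h] at this

theorem hasSmoothBoundary_quadratic (hA : A.toLinearMap.IsSymmetric)
    (hpos : ∀ v, 0 ≤ ⟪A v, v⟫_ℝ) (hG : G ≠ 0) :
    HasSmoothBoundary {y | quadratic p 0 G A y < 0} := fun _ hx =>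
  ⟨_, isDefiningFunction_quadratic hA hpos hG
    (frontier_lt_subset_eq contDiff_quadratic.continuous continuous_const hx)⟩

/-- The operator `H + s • 1 + m • G Gᵀ`. -/
def perturb (G : Space n) (H : Space n →L[ℝ] Space n) (s m : ℝ) : Space n →L[ℝ] Space n :=
  H + s • ContinuousLinearMap.id ℝ _ + m • (innerSL ℝ G).smulRight G

theorem inner_perturb (G : Space n) (H : Space n →L[ℝ] Space n) (s m : ℝ) (v w : Space n) :
    ⟪perturb G H s m v, w⟫_ℝ = ⟪H v, w⟫_ℝ + s * ⟪v, w⟫_ℝ + m * (⟪G, v⟫_ℝ * ⟪G, w⟫_ℝ) := by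
  simp only [perturb, add_apply, smul_apply, ContinuousLinearMap.id_apply,
    ContinuousLinearMap.smulRight_apply, innerSL_apply_apply, inner_add_left, real_inner_smul_left]

theorem inner_perturb_self (G : Space n) (H : Space n →L[ℝ] Space n) (s m : ℝ) (v : Space n) :
    ⟪perturb G H s m v, v⟫_ℝ = ⟪H v, v⟫_ℝ + s * ‖v‖ ^ 2 + m * ⟪G, v⟫_ℝ ^ 2 := by
  rw [inner_perturb, real_inner_self_eq_norm_sq, ← sq]

theorem isSymmetric_perturb {H : Space n →L[ℝ] Space n} (hH : H.toLinearMap.IsSymmetric) (s m : ℝ) :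
    (perturb G H s m).toLinearMap.IsSymmetric := by
  intro v w
  have := hH v w
  simp only [ContinuousLinearMap.coe_coe] at this ⊢
  rw [inner_perturb, ← real_inner_comm v (perturb G H s m w), inner_perturb, this,
    real_inner_comm v (H w), real_inner_comm v w]
  ring

/-- The term `m • G Gᵀ` vanishes on tangent vectors, so it can be used freely to make a quadric
convex or small. -/
theorem curvature_perturb {H : Space n →L[ℝ] Space n} (hH : H.toLinearMap.IsSymmetric)
    (hG : G ≠ 0) {s : ℝ} (m : ℝ)
    (hpos : ∀ v, ⟪G, v⟫_ℝ = 0 → 0 ≤ ⟪H v, v⟫_ℝ + s * ‖v‖ ^ 2) :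
    curvature G (perturb G H s m) = curvature G (perturb G H s 0) :=
  curvature_congr hG (isSymmetric_perturb hH s m) (isSymmetric_perturb hH s 0)
    (fun v hv => by rw [inner_perturb_self, hv]; simpa using hpos v hv)
    fun v hv => by rw [inner_perturb_self, inner_perturb_self, hv]; simp

theorem perturb_zero (G : Space n) (H : Space n →L[ℝ] Space n) : perturb G H 0 0 = H := by
  ext1 v
  simp [perturb]

theorem tendsto_curvature_perturb (hG : G ≠ 0) (H : Space n →L[ℝ] Space n) :
    Tendsto (fun s => curvature G (perturb G H s 0)) (𝓝 0) (𝓝 (curvature G H)) := by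
  have h1 : Continuous fun s : ℝ => perturb G H s 0 :=
    (continuous_const.add (continuous_id.smul continuous_const)).add continuous_const
  have h3 : ContinuousAt (fun s : ℝ => (G, perturb G H s 0)) 0 :=
    continuousAt_const.prodMk h1.continuousAt
  have h4 := continuousAt_curvature hG H
  rw [← perturb_zero G H] at h4
  have h5 := ContinuousAt.comp (f := fun s : ℝ => (G, perturb G H s 0)) (x := 0) h4 h3
  have h6 := h5.tendsto
  simp only [Function.comp_apply, perturb_zero] at h6
  exact h6

/-- The condition defining the type only has to be checked on ellipsoids. -/
theorem curvatureAtLeast_of_isOfType (hX : Convex ℝ X) (hXt : IsOfType (detSet n t) X univ)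
    (hp : p ∈ frontier X) (hf : ContDiff ℝ ∞ f) (hfp : f p = 0) (hG : gradient f p ≠ 0)
    (hle : ∀ᶠ x in 𝓝 p, f x < 0 → x ∈ interior X) : CurvatureAtLeast t f p := by
  have hpos := hessian_nonneg_of_convex hX hf hp.2 hfp hG hle
  refine ⟨hpos, ?_⟩
  set G := gradient f p
  set H := hessian f p with hH
  have hHs : H.toLinearMap.IsSymmetric := isSymmetric_hessian hf p
  refine ge_of_tendsto ((tendsto_curvature_perturb hG H).mono_left
    (nhdsWithin_le_nhds (s := Ioi 0))) ?_
  filter_upwards [self_mem_nhdsWithin] with δ hδ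
  replace hδ : 0 < δ := hδ
  -- Raising the Hessian by `δ` beats the Taylor error, so the quadric lies above `f` on this ball
  -- and its sublevel set lies in `interior X`. Letting `δ → 0` recovers the curvature of `f`.
  obtain ⟨ρ, hρ, hball⟩ := Metric.eventually_nhds_iff_ball.1
    (hle.and ((taylor_isLittleO hf p).def (show (0 : ℝ) < δ / 4 by positivity)))
  obtain ⟨m₀, hm₀, hm⟩ := exists_nonneg_add_mul_inner_sq hHs hG hpos
    (show (0 : ℝ) < δ / 2 by positivity)
  -- The minimum of `a + m₁ a² / 2` is `-1 / (2 * m₁) = -δ ρ² / 8`, so a negative value of the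
  -- quadric forces `‖x - p‖² < ρ² / 2`: the ellipsoid fits in the ball.
  set m₁ := 4 / (δ * ρ ^ 2) with hm₁
  have hm₁0 : 0 < m₁ := by positivity
  set A := perturb G H δ (m₀ + m₁) with hA
  have hAs : A.toLinearMap.IsSymmetric := isSymmetric_perturb hHs _ _
  have hAb : ∀ v, δ / 2 * ‖v‖ ^ 2 + m₁ * ⟪G, v⟫_ℝ ^ 2 ≤ ⟪A v, v⟫_ℝ := fun v => by
    have := hm m₀ le_rfl v
    rw [hA, inner_perturb_self]
    linarith
  have hA0 : ∀ v, 0 ≤ ⟪A v, v⟫_ℝ := fun v => le_trans (by positivity) (hAb v)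
  set U := {x | quadratic p 0 G A x < 0} with hU
  have hUopen : IsOpen U := isOpen_lt contDiff_quadratic.continuous continuous_const
  have hUball : U ⊆ Metric.ball p ρ := fun x hx => by
    have hx' : 0 + ⟪G, x - p⟫_ℝ + 2⁻¹ * ⟪A (x - p), x - p⟫_ℝ < 0 := hx
    have h1 := hAb (x - p)
    set a := ⟪G, x - p⟫_ℝ
    have h2 : -(1 / (2 * m₁)) ≤ a + 2⁻¹ * (m₁ * a ^ 2) := by
      have : a + 2⁻¹ * (m₁ * a ^ 2) + 1 / (2 * m₁) = (m₁ * a + 1) ^ 2 / (2 * m₁) := by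
        field_simp; ring
      have : 0 ≤ (m₁ * a + 1) ^ 2 / (2 * m₁) := by positivity
      linarith
    have h3 : 1 / (2 * m₁) = δ / 8 * ρ ^ 2 := by rw [hm₁]; field_simp; norm_num
    have h4 : δ / 4 * ‖x - p‖ ^ 2 < δ / 4 * ρ ^ 2 := by
      have : 0 < δ / 8 * ρ ^ 2 := by positivity
      linarith
    rw [mem_ball_iff_norm]
    exact lt_of_pow_lt_pow_left₀ 2 hρ.le (lt_of_mul_lt_mul_left h4 (by positivity))
  have hUX : U ⊆ interior X := fun x hx => by
    obtain ⟨h1, h2⟩ := hball x (hUball hx)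
    refine h1 (lt_of_le_of_lt ?_ hx)
    rw [Real.norm_eq_abs, Real.norm_eq_abs, abs_of_nonneg (sq_nonneg ‖x - p‖)] at h2
    have h3 := (le_abs_self _).trans h2
    simp only [quadratic, hfp, hA] at h3 ⊢
    rw [inner_perturb_self]
    have h4 : 0 ≤ (m₀ + m₁) * ⟪G, x - p⟫_ℝ ^ 2 := by positivity
    have h5 : 0 ≤ δ * ‖x - p‖ ^ 2 := by positivity
    change f x - (0 + ⟪G, x - p⟫_ℝ + 2⁻¹ * ⟪H (x - p), x - p⟫_ℝ) ≤ _ at h3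
    linarith
  have hpU : p ∈ frontier U := by
    refine ⟨?_, ?_⟩
    · have h := mem_closure_lt_of_gradient_ne_zero (f := quadratic p 0 G A) (p := p)
        contDiff_quadratic (by simpa [gradient_quadratic hAs] using hG)
      rwa [quadratic_self] at h
    · rw [hUopen.interior_eq]
      simp [hU, quadratic_self]
  have hdef := isDefiningFunction_quadratic hAs hA0 hG (quadratic_self (p := p))
  have hS := hXt p ⟨hp, mem_univ _⟩ U hUopen hUX (hasSmoothBoundary_quadratic hAs hA0 hG) hpU _ hdef
  have hc := ((shapeOperatorIn_detSet_iff hdef.smooth hdef.gradient_ne_zero).1 hS).2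
  rw [hessian_quadratic hAs, gradient_quadratic hAs] at hc
  simp only [sub_self, map_zero, add_zero] at hc
  rwa [hA, curvature_perturb hHs hG] at hc
  exact fun v hv => add_nonneg (hpos v hv) (by positivity)

end Types

/-! ### Stability under intersection, and cutting off pieces. -/

section Perron

variable {n : ℕ} {X : Set (Space n)} {p : Space n} {f : Space n → ℝ} {t : ℝ}
  {G : Space n} {A : Space n →L[ℝ] Space n}

theorem gradient_add_quadratic (hf : ContDiff ℝ ∞ f) (hA : A.toLinearMap.IsSymmetric) (c : ℝ) :
    gradient (fun x => f x + quadratic p c G A x) = fun x => gradient f x + (G + A (x - p)) := by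
  refine gradient_eq fun x => hasGradientAt_iff_hasFDerivAt.2 ?_
  rw [map_add]
  exact (hasGradientAt_iff_hasFDerivAt.1 ((hf.differentiable (by simp)) x).hasGradientAt).add
    (hasFDerivAt_quadratic hA x)

theorem hessian_add_quadratic (hf : ContDiff ℝ ∞ f) (hA : A.toLinearMap.IsSymmetric) (c : ℝ)
    (x : Space n) : hessian (fun x => f x + quadratic p c G A x) x = hessian f x + A := by
  rw [hessian, gradient_add_quadratic hf hA]
  have h := ((contDiff_quadratic (p := p) (c := c) (G := G) (A := A)))
  have h2 := (differentiable_gradient h x).hasFDerivAt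
  rw [gradient_quadratic hA] at h2
  have h3 := (((differentiable_gradient hf) x).hasFDerivAt.add h2).fderiv
  have h4 := hessian_quadratic (p := p) (c := c) (G := G) hA x
  rw [hessian, gradient_quadratic hA] at h4
  rw [h4] at h3
  exact h3

/-- Viscosity stability. If `f` touches the intersection from inside at `p` with curvature below
`t`, so does `φ = f + (s/2)‖x - p‖²` for small `s`, and its level sets near `p` also have curvature
below `t`. Some member `Y` misses a point very near `p`; minimising `φ` off the interior of `Y`
gives a level set touching `Y` from inside, a contradiction. -/
theorem isOfType_sInter {S : Set (Set (Space n))} (hconv : ∀ Y ∈ S, Convex ℝ Y)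
    (htype : ∀ Y ∈ S, IsOfType (detSet n t) Y univ) : IsOfType (detSet n t) (⋂₀ S) univ := by
  refine isOfType_of_forall fun p hp f hf hG hfp hle => ?_
  have hpos := hessian_nonneg_of_convex (convex_sInter hconv) hf hp.1.2 hfp hG hle
  refine ⟨hpos, le_of_not_gt fun hlt => ?_⟩
  obtain ⟨s, hs, hs0⟩ := (((tendsto_curvature_perturb hG (hessian f p)).mono_left
    (nhdsWithin_le_nhds (s := Ioi 0))).eventually_lt_const hlt |>.and self_mem_nhdsWithin).exists
  replace hs0 : 0 < s := hs0
  set B : Space n →L[ℝ] Space n := s • ContinuousLinearMap.id ℝ _ with hB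
  have hBs : B.toLinearMap.IsSymmetric := fun v w => by
    simp [hB, real_inner_smul_left, real_inner_smul_right]
  have hval : ∀ c x, f x + quadratic p c 0 B x = f x + c + s / 2 * ‖x - p‖ ^ 2 := fun c x => by
    simp only [quadratic, hB, inner_zero_left, smul_apply, ContinuousLinearMap.id_apply,
      real_inner_smul_left, real_inner_self_eq_norm_sq]
    ring
  have hgrad := fun c => gradient_add_quadratic (p := p) (G := 0) hf hBs c
  have hhess := fun c => hessian_add_quadratic (p := p) (G := 0) hf hBs c
  have hgc : Continuous fun x => gradient f x + (0 + B (x - p)) := by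
    have := (contDiff_gradient hf).continuous
    fun_prop
  have hcurv : ∀ᶠ x in 𝓝 p,
      curvature (gradient f x + (0 + B (x - p))) (hessian f x + B) < t := by
    have h1 : ContinuousAt (fun x => (gradient f x + (0 + B (x - p)), hessian f x + B)) p :=
      hgc.continuousAt.prodMk ((continuous_hessian hf).add continuous_const).continuousAt
    have h0 : gradient f p + (0 + B (p - p)) = gradient f p := by simp
    have h2 := ContinuousAt.comp
      (f := fun x => (gradient f x + (0 + B (x - p)), hessian f x + B)) (x := p)
      (continuousAt_curvature (by rwa [h0]) (hessian f p + B)) h1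
    refine h2.tendsto.eventually_lt_const ?_
    simp only [Function.comp_apply, h0]
    have : perturb (gradient f p) (hessian f p) s 0 = hessian f p + B := by
      ext1 v; simp [perturb, hB]
    rwa [← this]
  have hne : ∀ᶠ x in 𝓝 p, gradient f x + (0 + B (x - p)) ≠ 0 :=
    hgc.continuousAt.eventually_ne (by simpa using hG)
  obtain ⟨ρ, hρ, hball⟩ := Metric.nhds_basis_closedBall.mem_iff.1 (hle.and (hcurv.and hne))
  set φ : Space n → ℝ := fun x => f x + 0 + s / 2 * ‖x - p‖ ^ 2 with hφ
  have hφc : Continuous φ := by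
    have := hf.continuous
    fun_prop
  have hφp : φ p < s / 2 * ρ ^ 2 := by
    have : 0 < s / 2 * ρ ^ 2 := by positivity
    simpa [hφ, hfp] using this
  have hpc : p ∈ closure (⋂₀ S)ᶜ := by
    rw [closure_compl]; exact hp.1.2
  obtain ⟨x, hxK, hxφ, hxb⟩ := ((mem_closure_iff_frequently.1 hpc).and_eventually
    ((hφc.continuousAt.eventually_lt_const hφp).and (Metric.closedBall_mem_nhds p hρ))).exists
  obtain ⟨Y, hYS, hxY⟩ : ∃ Y ∈ S, x ∉ Y := by simpa using hxK
  obtain ⟨x₀, hx₀, hmin⟩ := ((isCompact_closedBall p ρ).inter_right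
    (isClosed_closure (s := Yᶜ))).exists_isMinOn ⟨x, hxb, subset_closure hxY⟩ hφc.continuousOn
  have hx₀Y : x₀ ∉ interior Y := by
    have := hx₀.2; rwa [closure_compl] at this
  -- Off `interior Y` one has `f ≥ 0`, so on the sphere `φ ≥ (s/2)ρ²`, which exceeds `φ x`. The
  -- minimum is therefore attained inside the ball.
  have hx₀b : x₀ ∈ Metric.ball p ρ := by
    refine lt_of_le_of_ne (Metric.mem_closedBall.1 hx₀.1) fun h => ?_
    rw [dist_eq_norm] at h
    have h1 : 0 ≤ f x₀ := le_of_not_gt fun h2 =>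
      hx₀Y (interior_mono (sInter_subset_of_mem hYS) ((hball hx₀.1).1 h2))
    have h2 : φ x₀ ≤ φ x := hmin ⟨hxb, subset_closure hxY⟩
    have h3 : φ x₀ = f x₀ + 0 + s / 2 * ρ ^ 2 := by simp only [hφ, h]
    linarith
  set g : Space n → ℝ := fun x => f x + quadratic p (-φ x₀) 0 B x with hg
  have hgφ : ∀ x, g x = φ x - φ x₀ := fun x => by
    simp only [hg, hval]; simp only [hφ]; ring
  have hgs : ContDiff ℝ ∞ g := hf.add contDiff_quadratic
  have hgG : gradient g x₀ ≠ 0 := by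
    rw [hg, hgrad]; exact (hball hx₀.1).2.2
  have hgle : ∀ᶠ x in 𝓝 x₀, g x < 0 → x ∈ interior Y := by
    filter_upwards [Metric.isOpen_ball.mem_nhds hx₀b] with y hy hgy
    by_contra hyY
    have : φ x₀ ≤ φ y :=
      hmin ⟨Metric.ball_subset_closedBall hy, by rw [closure_compl]; exact hyY⟩
    rw [hgφ] at hgy
    linarith
  have hgx₀ : g x₀ = 0 := by rw [hgφ, sub_self]
  have hx₀cl : x₀ ∈ closure Y := by
    have h1 := mem_closure_lt_of_gradient_ne_zero hgs hgG
    rw [hgx₀] at h1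
    rw [mem_closure_iff_frequently] at h1 ⊢
    exact (h1.and_eventually hgle).mono fun y hy => interior_subset (hy.2 hy.1)
  have := (curvatureAtLeast_of_isOfType (hconv Y hYS) (htype Y hYS) ⟨hx₀cl, hx₀Y⟩ hgs hgx₀ hgG
    hgle).2
  rw [hg, hgrad, hhess] at this
  exact absurd (hball hx₀.1).2.1 this.not_gt

/-- Cutting off a small piece of a convex set with a quadric. -/
theorem isOfType_diff_quadratic (hXc : IsCompact X) (hX : Convex ℝ X)
    (hXt : IsOfType (detSet n t) X univ) (hA : A.toLinearMap.IsSymmetric)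
    (hpos : ∀ v, 0 ≤ ⟪A v, v⟫_ℝ) {e r : ℝ} (he : 0 < e) (hr : 0 < r)
    (hQ : ∀ x ∈ X ∩ Metric.closedBall p r, quadratic p 0 G A x ≤ -(e * ‖x - p‖ ^ 2))
    (hcurv : ∀ x ∈ Metric.closedBall p r, G + A (x - p) ≠ 0 ∧ t ≤ curvature (G + A (x - p)) A) :
    ∃ Y ⊆ X, IsCompact Y ∧ Convex ℝ Y ∧ IsOfType (detSet n t) Y univ ∧ p ∉ Y ∧
      X \ Y ⊆ Metric.ball p r := by
  -- With this `η`, points of `X` in the closed ball with `-η ≤ Q` satisfy `‖x - p‖² ≤ r² / 2`, so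
  -- the cut stays away from the sphere.
  set η := e * r ^ 2 / 2 with hη
  have hη0 : 0 < η := by positivity
  set Q := quadratic p 0 G A with hQdef
  have hQc : Continuous Q := contDiff_quadratic.continuous
  set R := Metric.ball p r ∩ {x | -η < Q x} with hR
  have hRo : IsOpen R := Metric.isOpen_ball.inter (isOpen_lt continuous_const hQc)
  have hcl : IsClosed (X \ R) := hXc.isClosed.sdiff hRo
  refine ⟨X \ R, sdiff_subset, hXc.diff hRo, ?_, ?_, fun h => h.2 ⟨Metric.mem_ball_self hr, ?_⟩,
    fun x hx => ?_⟩
  · intro a ha b hb α β hα hβ hαβ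
    -- Going from `z` to `a`, one either ends in the ball outside `R` or crosses the sphere, where
    -- `Q ≤ -e r² ≤ -η`. Such points on both sides of `z` contradict convexity of `Q`.
    have key : ∀ a ∈ X \ R, ∀ z ∈ R, segment ℝ a z ⊆ X →
        ∃ y ∈ segment ℝ a z, Q y ≤ -η := by
      intro a ha z hz haz
      by_cases hab : a ∈ Metric.ball p r
      · exact ⟨a, left_mem_segment ℝ a z, le_of_not_gt fun h => ha.2 ⟨hab, h⟩⟩
      · obtain ⟨y, hy, hyr⟩ : r ∈ (fun y => dist y p) '' segment ℝ a z :=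
          (convex_segment a z).isPreconnected.intermediate_value (right_mem_segment ℝ a z)
            (left_mem_segment ℝ a z) (continuous_id.dist continuous_const).continuousOn
            ⟨(Metric.mem_ball.1 hz.1).le, not_lt.1 hab⟩
        refine ⟨y, hy, ?_⟩
        have := hQ y ⟨haz hy, hyr.le⟩
        rw [← dist_eq_norm, show dist y p = r from hyr] at this
        linarith
    have hzX : α • a + β • b ∈ X := hX ha.1 hb.1 hα hβ hαβ
    refine ⟨hzX, fun hzR => ?_⟩
    set z := α • a + β • b with hz
    obtain ⟨y, hy, hyQ⟩ := key a ha z hzR (hX.segment_subset ha.1 hzX)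
    obtain ⟨y', hy', hyQ'⟩ := key b hb z hzR (hX.segment_subset hb.1 hzX)
    -- The weights come from eliminating `a` and `b`; if their sum vanishes, then `y = z`.
    have hzs : z ∈ segment ℝ y y' := by
      obtain ⟨a₁, b₁, ha₁, -, hab₁, rfl⟩ := hy
      obtain ⟨a₂, b₂, ha₂, -, hab₂, rfl⟩ := hy'
      obtain rfl : b₁ = 1 - a₁ := by linarith
      obtain rfl : b₂ = 1 - a₂ := by linarith
      obtain rfl : β = 1 - α := by linarith
      have h₁ : 0 ≤ a₁ * (1 - α) := mul_nonneg ha₁ hβ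
      have h₂ : 0 ≤ a₂ * α := mul_nonneg ha₂ hα
      rcases (add_nonneg h₁ h₂).eq_or_lt with h0 | h0
      · have h₃ : a₁ * (1 - α) = 0 := by linarith
        have : a₁ • a + (1 - a₁) • z = z := by
          have : a₁ • a + (1 - a₁) • z = z + (a₁ * (1 - α)) • (a - b) := by rw [hz]; module
          rw [this, h₃, zero_smul, add_zero]
        rw [this]
        exact left_mem_segment ℝ _ _
      · set S := a₁ * (1 - α) + a₂ * α with hS
        refine ⟨S⁻¹ * (a₂ * α), S⁻¹ * (a₁ * (1 - α)), by positivity, by positivity, ?_, ?_⟩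
        · rw [← mul_add, add_comm, ← hS, inv_mul_cancel₀ h0.ne']
        · rw [mul_smul S⁻¹, mul_smul S⁻¹, ← smul_add, inv_smul_eq_iff₀ h0.ne', hS, hz]
          module
    have h1 := (convexOn_quadratic (p := p) (c := 0) (G := G) hA hpos).le_on_segment
      (mem_univ y) (mem_univ y') hzs
    have h2 : -η < Q z := hzR.2
    have h3 := h1.trans (max_le hyQ hyQ')
    exact absurd h2 h3.not_gt
  · refine isOfType_of_forall fun q hq f hf hfG hfq hle => ?_
    have hqY : q ∈ X \ R := by
      have := hq.1.1; rwa [hcl.closure_eq] at this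
    -- A boundary point of the new set is either a boundary point of `X`, which already has the
    -- type, or lies on the quadric `Q = -η`, which then serves as a barrier.
    by_cases hqX : q ∈ interior X
    swap
    · exact curvatureAtLeast_of_isOfType hX hXt ⟨subset_closure hqY.1, hqX⟩ hf hfq hfG
        (hle.mono fun x hx hfx => interior_mono sdiff_subset (hx hfx))
    have hqR : q ∈ closure R := by
      by_contra h
      refine hq.1.2 (mem_interior_iff_mem_nhds.2 ?_)
      filter_upwards [isOpen_interior.mem_nhds hqX, isClosed_closure.isOpen_compl.mem_nhds h]
        with x hx1 hx2
      exact ⟨interior_subset hx1, fun h => hx2 (subset_closure h)⟩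
    have hqb : q ∈ Metric.closedBall p r :=
      Metric.closure_ball_subset_closedBall (closure_mono inter_subset_left hqR)
    have hqη : -η ≤ Q q := closure_lt_subset_le continuous_const hQc
      (closure_mono inter_subset_right hqR)
    have hqball : q ∈ Metric.ball p r := by
      have h1 := hQ q ⟨hqY.1, hqb⟩
      have h2 : e * ‖q - p‖ ^ 2 < e * r ^ 2 := by
        have : 0 < e * r ^ 2 := by positivity
        linarith
      rw [mem_ball_iff_norm]
      exact lt_of_pow_lt_pow_left₀ 2 hr.le (lt_of_mul_lt_mul_left h2 he.le)
    have hqQ : Q q = -η := le_antisymm (le_of_not_gt fun h => hqY.2 ⟨hqball, h⟩) hqη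
    have hval : ∀ x, quadratic p η G A x = Q x + η := fun x => by
      simp only [hQdef, quadratic]; ring
    have hg : gradient (quadratic p η G A) q ≠ 0 := by
      rw [gradient_quadratic hA]; exact (hcurv q hqb).1
    refine CurvatureAtLeast.of_le (g := quadratic p η G A) ⟨?_, ?_⟩ hf contDiff_quadratic hfq
      (by rw [hval, hqQ, neg_add_cancel]) hfG hg ?_
    · rw [hessian_quadratic hA]; exact fun v _ => hpos v
    · rw [hessian_quadratic hA, gradient_quadratic hA]; exact (hcurv q hqb).2
    · filter_upwards [hle, Metric.isOpen_ball.mem_nhds hqball] with x hx hxb hfx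
      have h1 : x ∉ R := (interior_subset (hx hfx)).2
      have h2 : Q x ≤ -η := le_of_not_gt fun h => h1 ⟨hxb, h⟩
      rw [hval]; linarith
  · simp only [mem_ofPred_eq, hQdef, quadratic_self]
    linarith
  · by_contra h
    exact hx.2 ⟨hx.1, fun h' => h h'.1⟩

/-- If the boundary of `X` is touched from outside by a hypersurface of curvature larger than `t`,
then a neighbourhood of the contact point can be cut off. -/
theorem exists_subset_isOfType (ht : 0 < t) (hXc : IsCompact X) (hX : Convex ℝ X)
    (hXt : IsOfType (detSet n t) X univ) (hf : ContDiff ℝ ∞ f) (hfp : f p = 0)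
    (hG : gradient f p ≠ 0)
    (hpos : ∀ v, ⟪gradient f p, v⟫_ℝ = 0 → 0 ≤ ⟪hessian f p v, v⟫_ℝ)
    (hcurv : t < curvature (gradient f p) (hessian f p))
    (hle : ∀ᶠ x in 𝓝 p, x ∈ X → f x ≤ 0) {N : Set (Space n)} (hN : N ∈ 𝓝 p) :
    ∃ Y ⊆ X, IsCompact Y ∧ Convex ℝ Y ∧ IsOfType (detSet n t) Y univ ∧ p ∉ Y ∧ X \ Y ⊆ N := by
  have hHs : (hessian f p).toLinearMap.IsSymmetric := isSymmetric_hessian hf p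
  obtain ⟨c, hc, hcH⟩ := exists_pos_mul_norm_sq_le_of_curvature_ne_zero hG hHs hpos
    (ht.trans hcurv).ne'
  set G := gradient f p with hGdef
  set H := hessian f p with hHdef
  -- Lowering the Hessian by `s` makes the quadric flatter than the surface while its curvature
  -- stays above `t`. The bound `2 * s ≤ c` keeps `H - 2s` nonnegative on tangent vectors, and
  -- Finsler's lemma then makes `H - s + m G Gᵀ` nonnegative everywhere.
  obtain ⟨s, hs0, hsc, hst⟩ : ∃ s : ℝ,
      0 < s ∧ 2 * s ≤ c ∧ t < curvature G (perturb G H (-s) 0) := by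
    have h1 : Tendsto (fun s : ℝ => -s) (𝓝[>] 0) (𝓝 0) :=
      tendsto_nhdsGT_zero continuous_neg neg_zero
    have h2 : Tendsto (fun s : ℝ => 2 * s) (𝓝[>] 0) (𝓝 0) :=
      tendsto_nhdsGT_zero (by fun_prop) (mul_zero _)
    obtain ⟨s, ⟨h3, h4⟩, h5⟩ := ((((tendsto_curvature_perturb hG H).comp h1).eventually_const_lt
      hcurv).and (h2.eventually_lt_const hc)).and self_mem_nhdsWithin |>.exists
    exact ⟨s, h5, h4.le, h3⟩
  obtain ⟨m, hm0, hm⟩ := exists_nonneg_add_mul_inner_sq (isSymmetric_perturb hHs (-(2 * s)) 0) hG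
    (fun v hv => by
      rw [inner_perturb_self, hv]
      have := hcH v hv
      nlinarith [sq_nonneg ‖v‖]) hs0
  set A := perturb G H (-s) m with hA
  have hAs : A.toLinearMap.IsSymmetric := isSymmetric_perturb hHs _ _
  have hApos : ∀ v, 0 ≤ ⟪A v, v⟫_ℝ := fun v => by
    have := hm m le_rfl v
    rw [inner_perturb_self] at this
    rw [hA, inner_perturb_self]
    linarith
  have hAcurv : t < curvature G A := by
    rwa [hA, curvature_perturb hHs hG]
    intro v hv
    have := hcH v hv
    nlinarith [sq_nonneg ‖v‖]
  have hgc : Continuous fun x => G + A (x - p) := by fun_prop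
  have h1 : ∀ᶠ x in 𝓝 p, G + A (x - p) ≠ 0 := hgc.continuousAt.eventually_ne (by simpa using hG)
  have h2 : ∀ᶠ x in 𝓝 p, t < curvature (G + A (x - p)) A := by
    have h3 : ContinuousAt (fun x => (G + A (x - p), A)) p :=
      hgc.continuousAt.prodMk continuousAt_const
    have h0 : G + A (p - p) = G := by simp
    have h4 := ContinuousAt.comp (f := fun x => (G + A (x - p), A)) (x := p)
      (continuousAt_curvature (by rwa [h0]) A) h3
    refine h4.tendsto.eventually_const_lt ?_
    simpa only [Function.comp_apply, h0] using hAcurv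
  -- The gain from `-s` must absorb `m⟪G, x - p⟫² / 2`. With `a` the linear term and `b` the lower
  -- Taylor bound, `b ≤ 0` on `X`. Use `a² ≤ 2b² + 2(a - b)²`: near `p`, `m b²` is at most `-b`, and
  -- `a - b` is quadratic in `x - p`, so its square is negligible.
  have h3 : ∀ᶠ x in 𝓝 p, x ∈ X → quadratic p 0 G A x ≤ -(s / 8 * ‖x - p‖ ^ 2) := by
    set C := s / 8 + ‖H‖ with hC
    have e1 : ∀ᶠ x in 𝓝 p, m * C ^ 2 * ‖x - p‖ ^ 2 < s / 8 := by
      have : Continuous fun x => m * C ^ 2 * ‖x - p‖ ^ 2 := by fun_prop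
      exact this.continuousAt.eventually_lt_const (by simpa using hs0)
    have e2 : ∀ᶠ x in 𝓝 p,
        -m * (⟪G, x - p⟫_ℝ + 2⁻¹ * ⟪H (x - p), x - p⟫_ℝ - s / 8 * ‖x - p‖ ^ 2) < 1 := by
      have : Continuous fun x =>
        -m * (⟪G, x - p⟫_ℝ + 2⁻¹ * ⟪H (x - p), x - p⟫_ℝ - s / 8 * ‖x - p‖ ^ 2) := by fun_prop
      exact this.continuousAt.eventually_lt_const (by simp)
    filter_upwards [hle, e1, e2, (taylor_isLittleO hf p).def (show (0 : ℝ) < s / 8 by positivity)]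
      with x hx e1 e2 e3 hxX
    rw [Real.norm_eq_abs, Real.norm_eq_abs, abs_of_nonneg (sq_nonneg ‖x - p‖)] at e3
    have e4 := (abs_le.1 e3).1
    have e5 := hx hxX
    simp only [quadratic, hfp, ← hGdef, ← hHdef] at e4 ⊢
    rw [hA, inner_perturb_self]
    have e6 : |⟪H (x - p), x - p⟫_ℝ| ≤ ‖H‖ * ‖x - p‖ ^ 2 := by
      refine (abs_real_inner_le_norm _ _).trans ?_
      rw [sq, ← mul_assoc]
      gcongr
      exact H.le_opNorm _
    set a := ⟪G, x - p⟫_ℝ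
    set q := ⟪H (x - p), x - p⟫_ℝ
    set w := ‖x - p‖ ^ 2 with hw
    have hw0 : 0 ≤ w := sq_nonneg _
    set b := a + 2⁻¹ * q - s / 8 * w with hb
    have hb0 : b ≤ 0 := by linarith
    have hd : |a - b| ≤ C * w := by
      rw [abs_le] at e6 ⊢
      have h5 : 0 ≤ ‖H‖ * w := by positivity
      have h6 : C * w = s / 8 * w + ‖H‖ * w := by rw [hC]; ring
      have h7 : 0 ≤ s / 8 * w := by positivity
      constructor <;> linarith [e6.1, e6.2]
    have hd2 : m * (a - b) ^ 2 ≤ s / 8 * w := by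
      have : (a - b) ^ 2 ≤ (C * w) ^ 2 := sq_le_sq' (abs_le.1 hd).1 (abs_le.1 hd).2
      calc m * (a - b) ^ 2 ≤ m * (C * w) ^ 2 := by gcongr
        _ = (m * C ^ 2 * w) * w := by ring
        _ ≤ s / 8 * w := by gcongr
    have hb2 : b + m * b ^ 2 ≤ 0 := by nlinarith
    have ha2 : 2⁻¹ * (m * a ^ 2) ≤ m * b ^ 2 + m * (a - b) ^ 2 := by
      nlinarith [mul_nonneg hm0 (sq_nonneg (a - 2 * b))]
    have hsw : 0 ≤ s * w := by positivity
    linarith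
  obtain ⟨r, hr, hball⟩ := Metric.nhds_basis_closedBall.mem_iff.1
    (h1.and (h2.and (h3.and hN)))
  obtain ⟨Y, hYX, hY1, hY2, hY3, hpY, hXY⟩ := isOfType_diff_quadratic (p := p) (G := G) hXc hX hXt
    hAs hApos (e := s / 8) (by positivity) hr (fun x hx => (hball hx.2).2.2.1 hx.1)
    fun x hx => ⟨(hball hx).1, (hball hx).2.1.le⟩
  exact ⟨Y, hYX, hY1, hY2, hY3, hpY,
    hXY.trans (Metric.ball_subset_closedBall.trans fun x hx => (hball hx).2.2.2)⟩

end Perron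

/-! ### Minimality of the Perron intersection. -/

section Main

variable {n : ℕ} {K Ω : Set (Space n)} {t : ℝ}

theorem CurvatureAtLeast.of_convex {p : Space n} {f : Space n → ℝ} (hK : Convex ℝ K)
    (hp : p ∈ frontier K) (hf : IsDefiningFunction K p f) (ht : t ≤ gaussCurvature f p) :
    CurvatureAtLeast t f p :=
  ⟨hessian_nonneg_of_convex hK hf.smooth hp.2 (hf.apply_eq_zero hp) hf.gradient_ne_zero
    (hf.interior_iff.mono fun _ h => h.2), by
    rwa [gaussCurvature_eq hf.smooth hf.gradient_ne_zero] at ht⟩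

theorem isOfType_of_le_gaussCurvature (hK : Convex ℝ K) (hsmooth : HasSmoothBoundary K)
    (hcurv : ∀ p ∈ frontier K, ∀ f : Space n → ℝ, IsDefiningFunction K p f →
      t ≤ gaussCurvature f p) (W : Set (Space n)) : IsOfType (detSet n t) K W := by
  refine isOfType_of_forall fun p hp f hf hfG hfp hle => ?_
  obtain ⟨g, hg⟩ := hsmooth p hp.1
  refine (CurvatureAtLeast.of_convex hK hp.1 hg (hcurv p hp.1 g hg)).of_le hf hg.smooth hfp
    (hg.apply_eq_zero hp.1) hfG hg.gradient_ne_zero ?_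
  filter_upwards [hle, hg.interior_iff] with x h1 h2 h3
  exact (h2.1 (h1 h3)).le

theorem isOfDualType_sInter_perronFamily (hn : 1 ≤ n) (ht : 0 < t) {X C : Set (Space n)}
    (hC : C ⊆ frontier X) (hX : X ∈ perronFamily (detSet n t) (convexHull ℝ C) X) :
    IsOfDualType (detSet n t) (⋂₀ perronFamily (detSet n t) (convexHull ℝ C) X) (interior X) := by
  set K := ⋂₀ perronFamily (detSet n t) (convexHull ℝ C) X with hK
  have hKX : K ⊆ X := sInter_subset_of_mem hX
  have hCK : C ⊆ K := fun x hx Y hY => hY.2.2.1 (subset_convexHull ℝ C hx)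
  have hclosed : IsClosed K := isClosed_sInter fun Y hY => hY.1.isClosed
  have hcompact : IsCompact K := hX.1.of_isClosed_subset hclosed hKX
  have hconv : Convex ℝ K := convex_sInter fun Y hY => hY.2.1
  have htype : IsOfType (detSet n t) K univ :=
    isOfType_sInter (fun Y hY => hY.2.1) fun Y hY => hY.2.2.2.2
  rintro p ⟨hp, hpX⟩ U hU hUK - hpU f hf
  have hpK : p ∈ K := hclosed.frontier_subset hp
  -- The exterior set `U` is `{f < 0}`, so `-f` is nonpositive on `K` and touches it from outside,
  -- with the normal reversed.
  have hnormal : inwardNormal f = outwardNormal (fun x => -f x) := by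
    have : gradient (fun x => -f x) = fun x => -gradient f x := by
      funext x
      simp only [gradient, fderiv_fun_neg, map_neg]
    funext x
    simp only [inwardNormal, outwardNormal, this, norm_neg, smul_neg]
  have hG : gradient (fun x => -f x) p ≠ 0 := by
    have : gradient (fun x => -f x) p = -gradient f p := by
      simp only [gradient, fderiv_fun_neg, map_neg]
    rw [this]
    exact neg_ne_zero.2 hf.gradient_ne_zero
  rw [hnormal]
  refine shapeOperatorIn_closure_compl_detSet hn hf.smooth.neg hG ht fun hpos => le_of_not_gt
    fun hlt => ?_
  obtain ⟨Y, hYK, hYc, hYconv, hYt, hpY, hdiff⟩ := exists_subset_isOfType ht hcompact hconv htype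
    hf.smooth.neg (by rw [hf.apply_eq_zero hpU, neg_zero]) hG hpos hlt (by
      filter_upwards [hf.interior_iff] with x hx hxK
      rw [hU.interior_eq] at hx
      have : ¬ f x < 0 := fun h => hUK (hx.2 h) hxK
      linarith) (isOpen_interior.mem_nhds hpX)
  -- The removed piece lies in `interior X` while `C` lies in the frontier, so `Y` still contains
  -- `C` and competes, yet it misses `p`.
  refine hpY (hpK Y ⟨hYc, hYconv, convexHull_min (fun x hx => ?_) hYconv, hYK.trans hKX, hYt⟩)
  by_contra hxY
  exact (hC hx).2 (hdiff ⟨hCK hx, hxY⟩)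

end Main

end Plateau

end

theorem lemma4p1 (n : ℕ) (hn : 1 ≤ n) (Khat Ω : Set (Plateau.Space n)) (k t : ℝ)
    (hcompact : IsCompact Khat) (hconvex : StrictConvex ℝ Khat)
    (hsmooth : Plateau.HasSmoothBoundary Khat) (hk : 0 < k)
    (hcurv : ∀ p ∈ frontier Khat, ∀ f : Plateau.Space n → ℝ,
      Plateau.IsDefiningFunction Khat p f → k ≤ Plateau.gaussCurvature f p)
    (hΩ : Plateau.IsOpenInBoundary Khat Ω)
    (hΩsmooth : Plateau.HasSmoothBoundaryInBoundary Khat Ω)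
    (ht : 0 < t) (htk : t ≤ k)
    (hstrict : ∀ p ∈ Ω, ∀ f : Plateau.Space n → ℝ,
      Plateau.IsDefiningFunction Khat p f → t < Plateau.gaussCurvature f p) :
    ∃ K : Set (Plateau.Space n),
      IsCompact K ∧ Convex ℝ K ∧ K ⊆ Khat ∧
      convexHull ℝ (frontier Khat \ Ω) ⊆ K ∧
      K ∩ frontier Khat = frontier Khat \ Ω ∧
      Plateau.IsOfType (Plateau.detSet n t) K (interior Khat) ∧
      Plateau.IsOfDualType (Plateau.detSet n t) K (interior Khat) ∧
      K = ⋂₀ Plateau.perronFamily (Plateau.detSet n t)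
        (convexHull ℝ (frontier Khat \ Ω)) Khat := by
  have hconv := hconvex.convex
  have htype := Plateau.isOfType_of_le_gaussCurvature hconv hsmooth
    (fun p hp f hf => htk.trans (hcurv p hp f hf)) univ
  have hC : frontier Khat \ Ω ⊆ Khat :=
    sdiff_subset.trans hcompact.isClosed.frontier_subset
  have hmem : Khat ∈ Plateau.perronFamily (Plateau.detSet n t)
      (convexHull ℝ (frontier Khat \ Ω)) Khat :=
    ⟨hcompact, hconv, convexHull_min hC hconv, Subset.rfl, htype⟩
  have hsub := sInter_subset_of_mem hmem
  refine ⟨_, hcompact.of_isClosed_subset (isClosed_sInter fun Y hY => hY.1.isClosed) hsub,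
    convex_sInter fun Y hY => hY.2.1, hsub, subset_sInter fun Y hY => hY.2.2.1, ?_,
    fun p hp => Plateau.isOfType_sInter (fun Y hY => hY.2.1) (fun Y hY => hY.2.2.2.2) p
      ⟨hp.1, mem_univ p⟩,
    Plateau.isOfDualType_sInter_perronFamily hn ht sdiff_subset hmem, rfl⟩
  refine Subset.antisymm (fun p hp => ⟨hp.2, fun hpΩ => ?_⟩)
    fun p hp => ⟨fun Y hY => hY.2.2.1 (subset_convexHull ℝ _ hp), hp.1⟩
  obtain ⟨f, hf⟩ := hsmooth p hp.2
  have hlt := hstrict p hpΩ f hf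
  have hat := Plateau.CurvatureAtLeast.of_convex hconv hp.2 hf hlt.le
  rw [Plateau.gaussCurvature_eq hf.smooth hf.gradient_ne_zero] at hlt
  obtain ⟨O, hO, rfl⟩ := hΩ
  -- Here `Khat` itself is cut, with its own boundary as the touching surface. The piece is kept
  -- inside `O`, where the frontier is contained in `Ω`, so `frontier Khat \ Ω` survives.
  obtain ⟨Y, hYK, hYc, hYconv, hYt, hpY, hdiff⟩ := Plateau.exists_subset_isOfType ht hcompact hconv
    htype hf.smooth (hf.apply_eq_zero hp.2) hf.gradient_ne_zero hat.1 hlt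
    (hf.closure_iff.mono fun x hx h => hx.1 (subset_closure h)) (hO.mem_nhds hpΩ.2)
  refine hpY (hp.1 Y ⟨hYc, hYconv, convexHull_min (fun x hx => ?_) hYconv, hYK, hYt⟩)
  by_contra hxY
  exact hx.2 ⟨hx.1, hdiff ⟨hC hx, hxY⟩⟩
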